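/- **Setting.** Let $\mathcal S$ be a countable set of prompts with a distribution $\rho$, $\mathcal A$ a finite set of actions, $\pi_{\mathrm{ref}}$ a reference policy with $\pi_{\mathrm{ref}}(a|s)>0$ for all $s,a$, $R>0$, $\beta>0$, and $r^*:\mathcal S\times\mathcal A\to[0,R]$ a reward. A policy is a map $\pi:\mathcal S\to\Delta(\mathcal A)$. Write $\mathrm{KL}(\pi\|\pi_{\mathrm{ref}})=\mathbb E_{s\sim\rho}[\mathrm{KL}(\pi(\cdot|s)\|\pi_{\mathrm{ref}}(\cdot|s))]$, let $$J_\beta(\pi)=\mathbb E_{s\sim\rho,\,a\sim\pi(\cdot|s)}[r^*(s,a)]-\beta\,\mathrm{KL}(\pi\|\pi_{\mathrm{ref}}),$$ and let $\pi^*$ be a maximizer of $J_\beta$ over all policies. For a reward $r$ let $\mathbb P_r(y=1|s,a,\tilde a)=\sigma(r(s,a)-r(s,\tilde a))$ with $\sigma$ the sigmoid (Bradley–Terry model). Let $\Pi$ be a finite class of policies such that (I) $\pi^*\in\Pi$, and (II) $|\log\frac{\pi(a|s)}{\pi_{\mathrm{ref}}(a|s)}|\le R/\beta$ for all $\pi\in\Pi$,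 $s\in\mathcal S$, $a\in\mathcal A$ (with $\log 0=-\infty$). Let $\mathrm{conv}(\Pi)$ be its convex hull and let $\mathcal R^\Pi=\{r_{|\pi}:\pi\in\Pi\}$, where $$r_{|\pi}(s,a)=\mathrm{Clip}_{[0,R]}\Big[\beta\log\tfrac{\pi(a|s)}{\pi_{\mathrm{ref}}(a|s)}-\min_{a'\in\mathcal A}\beta\log\tfrac{\pi(a'|s)}{\pi_{\mathrm{ref}}(a'|s)}\Big].$$ *Data.* A dataset $\mathcal D=\{(s^t,a^t,\tilde a^t,y^t,\pi^t)\}_{t\le T}$, $T\ge1$, is generated sequentially: for each $t$, a (possibly randomized) algorithm draws $\pi^t\in\mathrm{conv}(\Pi)$ depending only on $\{(s^j,a^j,\tilde a^j,y^j,\pi^j)\}_{j<t}$, and then $s^t\sim\rho$, $a^t\sim\pi^t(\cdot|s^t)$, $\tilde a^t\sim\pi_{\mathrm{ref}}(\cdot|s^t)$, $y^t\sim\mathbb P_{r^*}(\cdot|s^t,a^t,\tilde a^t)$. *RPO.* With $$L_{\mathcal D}(r)=\frac1T\sum_{t\le T}\Big[-y^t\log\sigma\big(r(s^t,a^t)-r(s^t,\tilde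 a^t)\big)-(1-y^t)\log\sigma\big(r(s^t,\tilde a^t)-r(s^t,a^t)\big)\Big],\qquad \eta=(1+e^R)^{-2}\sqrt{\tfrac{24}{T}\log\tfrac{|\Pi|}{\delta}},$$ RPO run on $\mathcal D$ with $\mathrm{conv}(\Pi)$ and $\mathcal R^\Pi$ returns a policy $$\pi_{\mathrm{Dstl}}\in\arg\max_{\pi\in\mathrm{conv}(\Pi)}\ \min_{r\in\mathcal R^\Pi}\ L_{\mathcal D}(r)+\eta\Big(\mathbb E_{s\sim\rho,\,a\sim\pi(\cdot|s),\,\tilde a\sim\pi_{\mathrm{ref}}(\cdot|s)}[r(s,a)-r(s,\tilde a)]-\beta\,\mathrm{KL}(\pi\|\pi_{\mathrm{ref}})\Big).$$ **Theorem (online-to-offline distillation).** There is an absolute constant $C>0$ such that in every such setting, for every $\delta\in(0,1)$, every $T\ge1$ and every data-collecting algorithm, the set of maximizers defining $\pi_{\mathrm{Dstl}}$ is non-empty for every dataset, and with probability at least $1-\delta$ every such maximizer satisfies $$J_\beta(\pi^*)-J_\beta(\pi_{\mathrm{Dstl}})\ \le\ C\,e^{2R}\Big(1+\kappa\big(e^{2R/\beta}\big)\sum_{t=1}^T\frac{J_\beta(\pi^*)-J_\beta(\pi^t)}{\beta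 T}\Big)\sqrt{\frac1T\log\frac{|\Pi|}{\delta}},\qquad \kappa(x)=\frac{(x-1)^2}{x-1-\log x}.$$ -/

import Mathlib

open MeasureTheory ProbabilityTheory

noncomputable section

namespace RLHF

/-- Policies `π : S → Δ(A)`, written as `π s a` for the probability `π(a|s)`. -/
abbrev Policy (S A : Type*) [Fintype A] : Type _ :=
  {π : S → A → ℝ // ∀ s, π s ∈ stdSimplex ℝ A}

/-- One round of interaction: a prompt `s`, an action `a` of the learner, an action `ã` of the
reference policy, and the preference label `y` (`true` is `y = 1`, i.e. `a` is preferred). -/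
abbrev Outcome (S A : Type*) : Type _ := S × A × A × Bool

/-- An entry `(π, (s, a, ã, y))` of a dataset. -/
abbrev Datum (S A : Type*) [Fintype A] : Type _ := Policy S A × Outcome S A

/-- A KL-regularized RLHF problem. -/
structure Problem (S A : Type*) [Fintype A] [MeasurableSpace S] where
  /-- the prompt distribution -/
  ρ : Measure S
  isProb : IsProbabilityMeasure ρ
  /-- the reference policy -/
  ref : Policy S A
  ref_pos : ∀ s a, 0 < ref.1 s a
  /-- the range of the rewards -/
  R : ℝ
  R_pos : 0 < R
  /-- the regularization coefficient -/
  β : ℝ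
  β_pos : 0 < β
  /-- the ground-truth reward -/
  rstar : S → A → ℝ
  rstar_mem : ∀ s a, rstar s a ∈ Set.Icc 0 R

section

variable {S A : Type*} [Fintype A] [MeasurableSpace S]

namespace Problem

variable (M : Problem S A)

/-- `KL(π(·|s) ‖ π_ref(·|s))`. -/
def klAt (π : Policy S A) (s : S) : ℝ :=
  ∑ a, π.1 s a * Real.log (π.1 s a / M.ref.1 s a)

/-- `KL(π ‖ π_ref) = E_{s ∼ ρ} KL(π(·|s) ‖ π_ref(·|s))`. -/
def kl (π : Policy S A) : ℝ := ∫ s, M.klAt π s ∂M.ρ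

/-- `E_{s ∼ ρ, a ∼ π(·|s)} r(s, a)`. -/
def expReward (r : S → A → ℝ) (π : Policy S A) : ℝ := ∫ s, ∑ a, π.1 s a * r s a ∂M.ρ

/-- The regularized value `J_β(π)` under the ground-truth reward. -/
def J (π : Policy S A) : ℝ := M.expReward M.rstar π - M.β * M.kl π

/-- `π` maximizes `J_β` over all policies; policies of infinite KL divergence have value `-∞`
and are left out of the comparison. -/
def IsOptimal (π : Policy S A) : Prop :=
  Integrable (M.klAt π) M.ρ ∧ ∀ π' : Policy S A, Integrable (M.klAt π') M.ρ → M.J π' ≤ M.J π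

/-- The two conditions on the policy class: it contains the optimal policy, and
`|log (π(a|s) / π_ref(a|s))| ≤ R / β` for all its members (with `log 0 = -∞`). -/
structure ClassAssumption (Pi : Finset (Policy S A)) (πstar : Policy S A) : Prop where
  realizable : πstar ∈ Pi
  pos : ∀ π ∈ Pi, ∀ s a, 0 < π.1 s a
  bounded_ratio : ∀ π ∈ Pi, ∀ s a, |Real.log (π.1 s a / M.ref.1 s a)| ≤ M.R / M.β

/-- The Bradley-Terry preference probability `P_r(y | s, a, ã)`. -/
def pref (r : S → A → ℝ) (s : S) (a a' : A) (y : Bool) : ℝ :=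
  if y then Real.sigmoid (r s a - r s a') else 1 - Real.sigmoid (r s a - r s a')

/-- The probability of the outcome `(s, a, ã, y)` when
`s ∼ ρ, a ∼ π(·|s), ã ∼ π_ref(·|s), y ∼ P_{r*}(·|s, a, ã)`. -/
def outcomeProb (π : Policy S A) (z : Outcome S A) : ℝ :=
  M.ρ.real {z.1} * (π.1 z.1 z.2.1 * (M.ref.1 z.1 z.2.2.1 *
    pref M.rstar z.1 z.2.1 z.2.2.1 z.2.2.2))

lemma outcomeProb_nonneg (π : Policy S A) (z : Outcome S A) : 0 ≤ M.outcomeProb π z := by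
  unfold outcomeProb pref
  refine mul_nonneg measureReal_nonneg (mul_nonneg ((π.2 _).1 _)
    (mul_nonneg ((M.ref.2 _).1 _) ?_))
  split_ifs
  · exact Real.sigmoid_nonneg _
  · linarith [Real.sigmoid_le_one (M.rstar z.1 z.2.1 - M.rstar z.1 z.2.2.1)]

lemma measurable_outcomeProb (z : Outcome S A) :
    Measurable (fun π : Policy S A => M.outcomeProb π z) := by
  unfold outcomeProb
  have h : Measurable (fun π : Policy S A => π.1 z.1 z.2.1) :=
    (measurable_pi_apply z.2.1).comp ((measurable_pi_apply z.1).comp measurable_subtype_coe)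
  exact (h.mul_const _).const_mul _

end Problem

end

section

variable {S A : Type*} [Fintype A] [Countable S]
  [MeasurableSpace S] [MeasurableSingletonClass S]
  [MeasurableSpace A] [MeasurableSingletonClass A]

namespace Problem

variable (M : Problem S A)

/-- The law of one round of interaction, as a function of the policy that is played. -/
def outcomeKernel : Kernel (Policy S A) (Outcome S A) where
  toFun π := Measure.sum fun z => ENNReal.ofReal (M.outcomeProb π z) • Measure.dirac z
  measurable' := by
    refine Measure.measurable_of_measurable_coe _ fun t ht => ?_
    simp only [Measure.sum_apply _ ht, Measure.smul_apply, smul_eq_mul]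
    exact Measurable.tsum fun z =>
      (M.measurable_outcomeProb z).ennreal_ofReal.mul_const _

instance : IsMarkovKernel M.outcomeKernel := by
  refine ⟨fun π => ⟨?_⟩⟩
  have hρ := M.isProb
  change (Measure.sum fun z => ENNReal.ofReal (M.outcomeProb π z) • Measure.dirac z) Set.univ = 1
  rw [Measure.sum_apply _ MeasurableSet.univ]
  simp only [Measure.smul_apply, measure_univ, smul_eq_mul, mul_one]
  rw [ENNReal.tsum_prod']
  have key : ∀ s : S, ∑' w : A × A × Bool, ENNReal.ofReal (M.outcomeProb π (s, w)) = M.ρ {s} := by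
    intro s
    rw [tsum_fintype, ← ENNReal.ofReal_sum_of_nonneg fun w _ => M.outcomeProb_nonneg π (s, w)]
    have : ∑ w : A × A × Bool, M.outcomeProb π (s, w) = M.ρ.real {s} := by
      simp only [outcomeProb, Fintype.sum_prod_type, ← Finset.mul_sum]
      have h1 : ∀ a a' : A, ∑ y : Bool, pref M.rstar s a a' y = 1 := by
        intro a a'
        simp [pref]
      simp only [h1, mul_one, (π.2 s).2, (M.ref.2 s).2]
    rw [this, ofReal_measureReal]
  simp only [key]
  rw [← measure_univ (μ := M.ρ),
    ← Measure.tsum_indicator_apply_singleton M.ρ Set.univ MeasurableSet.univ]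
  simp

/-- The law of the first `n` entries of a sequentially generated dataset: `alg n` draws the next
policy from the history of the first `n` rounds, and then the outcome of the round is drawn. -/
def dataLaw (alg : (n : ℕ) → Kernel (Fin n → Datum S A) (Policy S A)) :
    (n : ℕ) → Measure (Fin n → Datum S A)
  | 0 => Measure.dirac Fin.elim0
  | n + 1 => (dataLaw alg n ⊗ₘ (alg n ⊗ₖ M.outcomeKernel.prodMkLeft (Fin n → Datum S A))).map
      fun p => Fin.snoc (α := fun _ => Datum S A) p.1 p.2

end Problem

end

section

variable {S A : Type*} [Fintype A] [MeasurableSpace S]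

/-- The convex hull `conv(Π)` of a policy class. -/
def convPolicies (Pi : Finset (Policy S A)) : Set (Policy S A) :=
  {π | π.1 ∈ convexHull ℝ (Subtype.val '' (Pi : Set (Policy S A)))}

/-- The average negative log-likelihood `L_D(r)`. -/
def nll {n : ℕ} (D : Fin n → Datum S A) (r : S → A → ℝ) : ℝ :=
  (1 / (n : ℝ)) * ∑ i, match (D i).2 with
    | (s, a, a', y) =>
      -((y.toNat : ℝ) * Real.log (Real.sigmoid (r s a - r s a')))
        - (1 - (y.toNat : ℝ)) * Real.log (Real.sigmoid (r s a' - r s a))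

/-- `κ(x) = (x - 1)² / (x - 1 - log x)`. -/
def kappa (x : ℝ) : ℝ := (x - 1) ^ 2 / (x - 1 - Real.log x)

namespace Problem

variable (M : Problem S A)

/-- The reward `r_{|π}` induced by a policy, clipped to `[0, R]`. -/
def rewardOf (π : Policy S A) (s : S) (a : A) : ℝ :=
  max 0 (min M.R (M.β * Real.log (π.1 s a / M.ref.1 s a)
    - ⨅ a', M.β * Real.log (π.1 s a' / M.ref.1 s a')))

/-- The reward class `R^Π` converted from the policy class `Π`. -/
def rewardClass (Pi : Finset (Policy S A)) : Set (S → A → ℝ) :=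
  M.rewardOf '' (Pi : Set (Policy S A))

/-- `E_{s ∼ ρ, a ∼ π(·|s), ã ∼ π_ref(·|s)} [r(s, a) - r(s, ã)]`. -/
def relReward (r : S → A → ℝ) (π : Policy S A) : ℝ :=
  ∫ s, ∑ a, ∑ a', π.1 s a * M.ref.1 s a' * (r s a - r s a') ∂M.ρ

/-- The RPO loss of a policy: the minimum over the (finite) reward class `R^Π` of
`L_D(r) + η (E[r(s, a) - r(s, ã)] - β KL(π ‖ π_ref))`. -/
def rpoObjective (Pi : Finset (Policy S A)) (η : ℝ) {n : ℕ} (D : Fin n → Datum S A)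
    (π : Policy S A) : ℝ :=
  ⨅ r : M.rewardClass Pi, (nll D r.1 + η * (M.relReward r.1 π - M.β * M.kl π))

/-- The possible outputs of RPO, run with `conv(Π)` and `R^Π`. -/
def rpo (Pi : Finset (Policy S A)) (η : ℝ) {n : ℕ} (D : Fin n → Datum S A) :
    Set (Policy S A) :=
  {π | π ∈ convPolicies Pi ∧ IsMaxOn (M.rpoObjective Pi η D) (convPolicies Pi) π}

/-- The weight `η` used by RPO on a dataset of `T` entries. -/
def rpoEta (Pi : Finset (Policy S A)) (T : ℕ) (δ : ℝ) : ℝ :=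
  ((1 + Real.exp M.R) ^ 2)⁻¹ * Real.sqrt (24 / T * Real.log (Pi.card / δ))

end Problem

end

section

variable {S A : Type*} [Fintype A] [Countable S]
  [MeasurableSpace S] [MeasurableSingletonClass S]
  [MeasurableSpace A] [MeasurableSingletonClass A]

instance (M : Problem S A) (alg : (n : ℕ) → Kernel (Fin n → Datum S A) (Policy S A))
    [∀ n, IsMarkovKernel (alg n)] (n : ℕ) : IsProbabilityMeasure (M.dataLaw alg n) := by
  induction n with
  | zero => unfold Problem.dataLaw; infer_instance
  | succ n ih =>
    unfold Problem.dataLaw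
    refine Measure.isProbabilityMeasure_map (Measurable.aemeasurable ?_)
    refine measurable_pi_lambda _ fun i => ?_
    refine Fin.lastCases ?_ (fun j => ?_) i
    · simpa using measurable_snd
    · simpa using! (measurable_pi_apply j).comp measurable_fst

end

end RLHF

end

/-!
The proof compares the RPO output directly with `π*`, which is feasible because it lies in `conv(Π)`;
no minimax theorem is needed.

The optimal policy has the Gibbs form `π*(a|s) ∝ π_ref(a|s) e^{r*(s,a)/β}` on the support of `ρ`
(`IsOptimal.ae_eq_gibbs`). Two facts follow. The reward read off from `π*` has the same gaps as `r*`
there, so it is a member of `R^Π` that represents the truth (`IsOptimal.ae_rewardOf_sub`). And the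
suboptimality of a policy is a divergence, `J(π*) - J(π) = β E_ρ KL(π ‖ π*)` (`IsOptimal.J_sub_eq`).

Testing the RPO objective at `π*` bounds `η (J(π*) - J(π_Dstl))` by a difference of negative
log-likelihoods `L(r*) - L(r)` plus `η E_{π*, π_ref}[Δ]`, where `Δ` is the difference of the gaps of `r*` and `r`, for
the reward `r ∈ R^Π` that is worst at `π*` (`exists_regret_le`). Both terms are handled as follows.

* The product of the square roots of the likelihood ratios of `r` against `r*`, each normalized by
  its conditional mean, is a supermartingale (`lintegral_prod_normalized_le_one`). The conditional
  mean is the affinity of two Bradley-Terry models, at most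
  `exp(-e^{-2R} E_{π^t, π_ref}[Δ²] / 64)` (`lintegral_rootRatio_le`). Markov's inequality and a union
  bound over `Π` make `L(r*) - L(r)` at most a confidence term minus the average of
  `e^{-2R} E_{π^t, π_ref}[Δ²] / 32`.
* By the inequality of arithmetic and geometric means, `E_{π*}[Δ]` is at most a multiple of
  `E_ρ ∑ₐ (π*)² / π^t` plus a multiple of `E_{π^t}[Δ²]` (`IsOptimal.pairMean_le`). The first is
  `1 + χ²(π* ‖ π^t)`, and `κ(e^{2R/β})` compares this `χ²`-divergence with `KL(π^t ‖ π*)`, hence with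
  the suboptimality of `π^t` (`sum_sq_div_le`, `sq_sub_one_le_kappa_mul`).

With the right weights the terms in `Δ²` cancel, and `η` balances what remains (`regret_le`).
-/

namespace RLHF

/-! ### Scalar inequalities -/

/-- On `[-R, R]` the sigmoid shrinks distances by a factor of at least `e^{-R} / 4`. The midpoint form
`e^x - e^y = e^{(x+y)/2} · 2 sinh((x-y)/2)` gives the rate `e^{-R}`; bounding `σ'` factor by factor
would only give `e^{-2R}`. -/
lemma exp_neg_mul_abs_sub_le_abs_sigmoid_sub {R x y : ℝ} (hx : |x| ≤ R) (hy : |y| ≤ R) :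
    Real.exp (-R) / 4 * |x - y| ≤ |Real.sigmoid x - Real.sigmoid y| := by
  wlog hxy : y ≤ x generalizing x y
  · rw [abs_sub_comm x y, abs_sub_comm (Real.sigmoid x)]
    exact this hy hx (le_of_not_ge hxy)
  rw [abs_of_nonneg (sub_nonneg.2 hxy), abs_of_nonneg (sub_nonneg.2 (Real.sigmoid_le hxy))]
  obtain ⟨hx1, hx2⟩ := abs_le.1 hx
  obtain ⟨hy1, hy2⟩ := abs_le.1 hy
  set u := Real.exp (x / 2) with hu
  set v := Real.exp (y / 2) with hv
  set w := Real.exp (R / 2) with hw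
  have hu0 : 0 < u := Real.exp_pos _
  have hv0 : 0 < v := Real.exp_pos _
  have hw0 : 0 < w := Real.exp_pos _
  have hnx : Real.exp (-x) = (u ^ 2)⁻¹ := by
    rw [hu, ← Real.exp_nat_mul, ← Real.exp_neg]; congr 1; push_cast; ring
  have hny : Real.exp (-y) = (v ^ 2)⁻¹ := by
    rw [hv, ← Real.exp_nat_mul, ← Real.exp_neg]; congr 1; push_cast; ring
  have hnR : Real.exp (-R) = (w ^ 2)⁻¹ := by
    rw [hw, ← Real.exp_nat_mul, ← Real.exp_neg]; congr 1; push_cast; ring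
  -- `2 sinh (d / 2) ≥ d` with `d = x - y`
  have hsinh : x - y ≤ u / v - v / u := by
    have h1 : u / v = Real.exp ((x - y) / 2) := by
      rw [hu, hv, ← Real.exp_sub]; congr 1; ring
    have h2 : v / u = Real.exp (-((x - y) / 2)) := by
      rw [hu, hv, ← Real.exp_sub]; congr 1; ring
    have h3 := Real.self_le_sinh_iff.2 (show 0 ≤ (x - y) / 2 by linarith)
    rw [Real.sinh_eq] at h3
    rw [h1, h2]
    linarith
  -- `2 cosh (z / 2) ≤ 2 e^{R/2}` for `z = x, y`
  have hcx : u + u⁻¹ ≤ 2 * w := by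
    have h1 : u ≤ w := Real.exp_le_exp.2 (by linarith)
    have h2 : u⁻¹ ≤ w := by rw [hu, ← Real.exp_neg]; exact Real.exp_le_exp.2 (by linarith)
    linarith
  have hcy : v + v⁻¹ ≤ 2 * w := by
    have h1 : v ≤ w := Real.exp_le_exp.2 (by linarith)
    have h2 : v⁻¹ ≤ w := by rw [hv, ← Real.exp_neg]; exact Real.exp_le_exp.2 (by linarith)
    linarith
  have hdiff : Real.sigmoid x - Real.sigmoid y
      = (u / v - v / u) / ((u + u⁻¹) * (v + v⁻¹)) := by
    rw [Real.sigmoid_def, Real.sigmoid_def, hnx, hny]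
    field_simp
    ring
  rw [hdiff, hnR, le_div_iff₀ (by positivity)]
  have hprod : (u + u⁻¹) * (v + v⁻¹) ≤ 4 * w ^ 2 := by
    calc (u + u⁻¹) * (v + v⁻¹) ≤ (2 * w) * (2 * w) := by gcongr
      _ = 4 * w ^ 2 := by ring
  calc (w ^ 2)⁻¹ / 4 * (x - y) * ((u + u⁻¹) * (v + v⁻¹))
      ≤ (w ^ 2)⁻¹ / 4 * (x - y) * (4 * w ^ 2) := by
        have := sub_nonneg.2 hxy
        gcongr
    _ = x - y := by field_simp
    _ ≤ _ := hsinh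

/-- The Bhattacharyya coefficient of two Bernoulli laws is bounded away from `1` by the squared
distance of the parameters. -/
lemma sqrt_mul_add_sqrt_mul_le {p q : ℝ} (hp : p ∈ Set.Icc (0 : ℝ) 1)
    (hq : q ∈ Set.Icc (0 : ℝ) 1) :
    √(p * q) + √((1 - p) * (1 - q)) ≤ 1 - (p - q) ^ 2 / 4 := by
  have hp' := sub_nonneg.2 hp.2
  have hq' := sub_nonneg.2 hq.2
  rw [Real.sqrt_mul hp.1, Real.sqrt_mul hp']
  have ha := Real.sq_sqrt hp.1
  have hb := Real.sq_sqrt hq.1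
  have hc := Real.sq_sqrt hp'
  have hd := Real.sq_sqrt hq'
  have ha1 : √p ≤ 1 := Real.sqrt_le_one.2 hp.2
  have hb1 : √q ≤ 1 := Real.sqrt_le_one.2 hq.2
  have hc1 : √(1 - p) ≤ 1 := Real.sqrt_le_one.2 (by linarith [hp.1])
  have hd1 : √(1 - q) ≤ 1 := Real.sqrt_le_one.2 (by linarith [hq.1])
  have key : ∀ u v : ℝ, 0 ≤ u → 0 ≤ v → u ≤ 1 → v ≤ 1 →
      (u ^ 2 - v ^ 2) ^ 2 ≤ 4 * (u - v) ^ 2 := by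
    intro u v hu hv hu1 hv1
    have h1 : (u + v) ^ 2 ≤ 2 ^ 2 := by gcongr; linarith
    calc (u ^ 2 - v ^ 2) ^ 2 = (u + v) ^ 2 * (u - v) ^ 2 := by ring
      _ ≤ 2 ^ 2 * (u - v) ^ 2 := by gcongr
      _ = _ := by ring
  have h1 := key _ _ (Real.sqrt_nonneg p) (Real.sqrt_nonneg q) ha1 hb1
  have h2 := key _ _ (Real.sqrt_nonneg (1 - p)) (Real.sqrt_nonneg (1 - q)) hc1 hd1
  rw [ha, hb] at h1
  rw [hc, hd] at h2
  nlinarith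

lemma sub_one_sub_log_pos {X : ℝ} (hX : 1 < X) : 0 < X - 1 - Real.log X := by
  have := Real.log_lt_sub_one_of_pos (by linarith) hX.ne'
  linarith

lemma kappa_pos {X : ℝ} (hX : 1 < X) : 0 < kappa X :=
  div_pos (by nlinarith) (sub_one_sub_log_pos hX)

/-- `κ` is monotone, in the form in which it compares the `χ²`- with the `KL`-integrand: the
difference `x - 1 - log x - (x - 1)² / κ(X)` vanishes at `1` and `X`, decreases on `(0, 1]`,
increases on `[1, κ(X) / 2]` and decreases afterwards. -/
lemma sq_sub_one_le_kappa_mul {x X : ℝ} (hx : 0 < x) (hX : 1 < X) (hxX : x ≤ X) :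
    (x - 1) ^ 2 ≤ kappa X * (x - 1 - Real.log x) := by
  have hlog := sub_one_sub_log_pos hX
  have hk := kappa_pos hX
  set k := kappa X with hkdef
  have hXk : k * (X - 1 - Real.log X) = (X - 1) ^ 2 := by
    rw [hkdef, kappa, div_mul_cancel₀ _ hlog.ne']
  set g : ℝ → ℝ := fun x => k * (x - 1 - Real.log x) - (x - 1) ^ 2 with hg
  have hderiv : ∀ z, 0 < z → HasDerivAt g ((z - 1) * (k / z - 2)) z := by
    intro z hz
    have h := ((((hasDerivAt_id z).sub_const 1).sub (Real.hasDerivAt_log hz.ne')).const_mul k).sub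
      (((hasDerivAt_id z).sub_const 1).pow 2)
    convert! h using 1
    simp
    field_simp
  have hk2 : 2 ≤ k := by
    rw [hkdef, kappa, le_div_iff₀ hlog]
    -- `X - 1 - log X ≤ (X - 1)² / 2`, again by monotonicity on `[1, ∞)`
    have hmono : MonotoneOn (fun z : ℝ => (z - 1) ^ 2 - 2 * (z - 1 - Real.log z)) (Set.Ici 1) := by
      have hd : ∀ z : ℝ, 0 < z →
          HasDerivAt (fun z : ℝ => (z - 1) ^ 2 - 2 * (z - 1 - Real.log z))
            (2 * (z - 1) ^ 2 / z) z := by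
        intro z hz
        have h := (((hasDerivAt_id z).sub_const 1).pow 2).sub
          ((((hasDerivAt_id z).sub_const 1).sub (Real.hasDerivAt_log hz.ne')).const_mul 2)
        convert! h using 1
        simp
        field_simp
      refine monotoneOn_of_deriv_nonneg (convex_Ici 1) ?_ ?_ ?_
      · exact fun z hz => (hd z (lt_of_lt_of_le one_pos hz)).continuousAt.continuousWithinAt
      · intro z hz
        rw [interior_Ici] at hz
        exact (hd z (one_pos.trans hz)).differentiableAt.differentiableWithinAt
      · intro z hz
        rw [interior_Ici] at hz
        have hz0 : (0 : ℝ) < z := one_pos.trans hz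
        rw [(hd z hz0).deriv]
        positivity
    have := hmono (Set.mem_Ici.2 le_rfl) (Set.mem_Ici.2 hX.le) hX.le
    simp at this
    linarith
  have hg1 : g 1 = 0 := by simp [hg]
  have hgX : g X = 0 := by simp [hg, hXk]
  suffices h : 0 ≤ g x by simp only [hg] at h; linarith
  have hcont : ∀ s : Set ℝ, (∀ z ∈ s, 0 < z) → ContinuousOn g s := fun s hs z hz =>
    (hderiv z (hs z hz)).continuousAt.continuousWithinAt
  rcases le_total x 1 with hx1 | hx1
  · have hanti : AntitoneOn g (Set.Icc x 1) := by
      refine antitoneOn_of_deriv_nonpos (convex_Icc x 1) (hcont _ fun z hz => hx.trans_le hz.1) ?_ ?_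
      · intro z hz
        rw [interior_Icc] at hz
        exact (hderiv z (hx.trans hz.1)).differentiableAt.differentiableWithinAt
      · intro z hz
        rw [interior_Icc] at hz
        have hz0 := hx.trans hz.1
        rw [(hderiv z hz0).deriv]
        have h2 : 2 ≤ k / z := by
          rw [le_div_iff₀ hz0]; nlinarith [hz.2]
        exact mul_nonpos_of_nonpos_of_nonneg (by linarith [hz.2]) (by linarith)
    have := hanti (Set.left_mem_Icc.2 hx1) (Set.right_mem_Icc.2 hx1) hx1
    rwa [hg1] at this
  · rcases le_total x (k / 2) with hxk | hxk
    · have hmono : MonotoneOn g (Set.Icc 1 x) := by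
        refine monotoneOn_of_deriv_nonneg (convex_Icc 1 x)
          (hcont _ fun z hz => one_pos.trans_le hz.1) ?_ ?_
        · intro z hz
          rw [interior_Icc] at hz
          exact (hderiv z (one_pos.trans hz.1)).differentiableAt.differentiableWithinAt
        · intro z hz
          rw [interior_Icc] at hz
          have hz0 := one_pos.trans hz.1
          rw [(hderiv z hz0).deriv]
          have h2 : 2 ≤ k / z := by
            rw [le_div_iff₀ hz0]; linarith [hz.2]
          exact mul_nonneg (by linarith [hz.1]) (by linarith)
      have := hmono (Set.left_mem_Icc.2 hx1) (Set.right_mem_Icc.2 hx1) hx1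
      rwa [hg1] at this
    · have hanti : AntitoneOn g (Set.Icc x X) := by
        refine antitoneOn_of_deriv_nonpos (convex_Icc x X)
          (hcont _ fun z hz => hx.trans_le hz.1) ?_ ?_
        · intro z hz
          rw [interior_Icc] at hz
          exact (hderiv z (hx.trans hz.1)).differentiableAt.differentiableWithinAt
        · intro z hz
          rw [interior_Icc] at hz
          have hz0 := hx.trans hz.1
          rw [(hderiv z hz0).deriv]
          have h2 : k / z ≤ 2 := by
            rw [div_le_iff₀ hz0]; linarith [hz.1]
          exact mul_nonpos_of_nonneg_of_nonpos (by linarith [hz.1]) (by linarith)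
      have := hanti (Set.left_mem_Icc.2 hxX) (Set.right_mem_Icc.2 hxX) hxX
      rwa [hgX] at this

/-! ### Averages and divergences of policies -/

section

variable {S A : Type*} [Fintype A]

lemma sum_le_of_le_policy (π : Policy S A) (s : S) {f : A → ℝ} {c : ℝ} (h : ∀ a, f a ≤ c) :
    ∑ a, π.1 s a * f a ≤ c := by
  calc ∑ a, π.1 s a * f a ≤ ∑ a, π.1 s a * c :=
        Finset.sum_le_sum fun a _ => mul_le_mul_of_nonneg_left (h a) ((π.2 s).1 a)
    _ = c := by rw [← Finset.sum_mul, (π.2 s).2, one_mul]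

lemma abs_sum_le_of_abs_le_policy (π : Policy S A) (s : S) {f : A → ℝ} {c : ℝ}
    (h : ∀ a, |f a| ≤ c) : |∑ a, π.1 s a * f a| ≤ c := by
  refine (Finset.abs_sum_le_sum_abs _ _).trans ?_
  simp only [abs_mul, abs_of_nonneg ((π.2 s).1 _)]
  exact sum_le_of_le_policy π s h

/-- `KL(π(·|s) ‖ q(·|s))` for two policies. -/
noncomputable def klPair (π q : Policy S A) (s : S) : ℝ :=
  ∑ a, π.1 s a * Real.log (π.1 s a / q.1 s a)

lemma klPair_eq_sum_klFun (π q : Policy S A) (s : S) (hq : ∀ a, 0 < q.1 s a) :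
    klPair π q s = ∑ a, q.1 s a * InformationTheory.klFun (π.1 s a / q.1 s a) := by
  have h : ∀ a, q.1 s a * InformationTheory.klFun (π.1 s a / q.1 s a)
      = π.1 s a * Real.log (π.1 s a / q.1 s a) + q.1 s a - π.1 s a := by
    intro a
    have := (hq a).ne'
    rw [InformationTheory.klFun_apply]
    field_simp
  simp only [h, Finset.sum_sub_distrib, Finset.sum_add_distrib, (π.2 s).2, (q.2 s).2, klPair]
  ring

lemma klPair_nonneg {π q : Policy S A} {s : S} (hq : ∀ a, 0 < q.1 s a) : 0 ≤ klPair π q s := by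
  rw [klPair_eq_sum_klFun π q s hq]
  exact Finset.sum_nonneg fun a _ => mul_nonneg (hq a).le
    (InformationTheory.klFun_nonneg (div_nonneg ((π.2 s).1 a) (hq a).le))

lemma eq_of_klPair_eq_zero {π q : Policy S A} {s : S} (hq : ∀ a, 0 < q.1 s a)
    (h : klPair π q s = 0) : π.1 s = q.1 s := by
  have hnn : ∀ a, 0 ≤ π.1 s a / q.1 s a := fun a => div_nonneg ((π.2 s).1 a) (hq a).le
  rw [klPair_eq_sum_klFun π q s hq, Finset.sum_eq_zero_iff_of_nonneg fun a _ =>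
    mul_nonneg (hq a).le (InformationTheory.klFun_nonneg (hnn a))] at h
  funext a
  have ha := (mul_eq_zero.1 (h a (Finset.mem_univ a))).resolve_left (hq a).ne'
  rw [InformationTheory.klFun_eq_zero_iff (hnn a), div_eq_one_iff_eq (hq a).ne'] at ha
  exact ha

/-- If `π / q ≤ X`, the second moment `∑ₐ π² / q = 1 + χ²(π ‖ q)` is controlled by the reverse
divergence `KL(q ‖ π)` with the factor `κ(X)`. -/
lemma sum_sq_div_le {π q : Policy S A} {s : S} {X : ℝ} (hπ : ∀ a, 0 < π.1 s a)
    (hq : ∀ a, 0 < q.1 s a) (hX : 1 < X) (h : ∀ a, π.1 s a / q.1 s a ≤ X) :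
    ∑ a, π.1 s a ^ 2 / q.1 s a ≤ 1 + kappa X * klPair q π s := by
  have key : ∀ a, π.1 s a ^ 2 / q.1 s a ≤ 2 * π.1 s a - q.1 s a +
      kappa X * (π.1 s a - q.1 s a + q.1 s a * Real.log (q.1 s a / π.1 s a)) := by
    intro a
    have h1 := sq_sub_one_le_kappa_mul (div_pos (hπ a) (hq a)) hX (h a)
    have h2 := mul_le_mul_of_nonneg_left h1 (hq a).le
    have hlog : Real.log (q.1 s a / π.1 s a) = -Real.log (π.1 s a / q.1 s a) := by
      rw [← Real.log_inv, inv_div]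
    have hqa := (hq a).ne'
    have e1 : q.1 s a * (π.1 s a / q.1 s a - 1) ^ 2
        = π.1 s a ^ 2 / q.1 s a - 2 * π.1 s a + q.1 s a := by field_simp; ring
    have e2 : q.1 s a * (kappa X * (π.1 s a / q.1 s a - 1 - Real.log (π.1 s a / q.1 s a)))
        = kappa X * (π.1 s a - q.1 s a - q.1 s a * Real.log (π.1 s a / q.1 s a)) := by field_simp
    rw [e1, e2] at h2
    rw [hlog]
    linarith
  refine (Finset.sum_le_sum fun a _ => key a).trans (le_of_eq ?_)
  simp only [Finset.sum_add_distrib, Finset.sum_sub_distrib, ← Finset.mul_sum, (π.2 s).2,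
    (q.2 s).2, klPair]
  ring

end

/-! ### Policies comparable with the reference policy -/

section

variable {S A : Type*} [Fintype A] [MeasurableSpace S]

namespace Problem

variable (M : Problem S A)

/-- The density ratio of `π` with respect to `π_ref` lies in `[e^{-R/β}, e^{R/β}]`, at every prompt
and for every action. -/
def RatioBounded (π : Policy S A) : Prop :=
  ∀ s a, Real.exp (-(M.R / M.β)) * M.ref.1 s a ≤ π.1 s a ∧
    π.1 s a ≤ Real.exp (M.R / M.β) * M.ref.1 s a

variable {M}

lemma RatioBounded.pos {π : Policy S A} (h : M.RatioBounded π) (s : S) (a : A) : 0 < π.1 s a :=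
  (mul_pos (Real.exp_pos _) (M.ref_pos s a)).trans_le (h s a).1

lemma ratioBounded_of_abs_log_le {π : Policy S A} (hpos : ∀ s a, 0 < π.1 s a)
    (h : ∀ s a, |Real.log (π.1 s a / M.ref.1 s a)| ≤ M.R / M.β) : M.RatioBounded π := by
  intro s a
  have hr := M.ref_pos s a
  obtain ⟨h1, h2⟩ := abs_le.1 (h s a)
  rw [Real.le_log_iff_exp_le (div_pos (hpos s a) hr), le_div_iff₀ hr] at h1
  rw [Real.log_le_iff_le_exp (div_pos (hpos s a) hr), div_le_iff₀ hr] at h2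
  exact ⟨h1, h2⟩

lemma RatioBounded.abs_log_le {π : Policy S A} (h : M.RatioBounded π) (s : S) (a : A) :
    |Real.log (π.1 s a / M.ref.1 s a)| ≤ M.R / M.β := by
  have hr := M.ref_pos s a
  have hp := div_pos (h.pos s a) hr
  rw [abs_le, Real.le_log_iff_exp_le hp, le_div_iff₀ hr, Real.log_le_iff_le_exp hp,
    div_le_iff₀ hr]
  exact h s a

lemma RatioBounded.div_le {π π' : Policy S A} (h : M.RatioBounded π) (h' : M.RatioBounded π')
    (s : S) (a : A) : π.1 s a / π'.1 s a ≤ Real.exp (2 * M.R / M.β) := by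
  rw [div_le_iff₀ (h'.pos s a)]
  calc π.1 s a ≤ Real.exp (M.R / M.β) * M.ref.1 s a := (h s a).2
    _ = Real.exp (2 * M.R / M.β) * (Real.exp (-(M.R / M.β)) * M.ref.1 s a) := by
        rw [← mul_assoc, ← Real.exp_add]; congr 2; ring
    _ ≤ _ := by gcongr; exact (h' s a).1

lemma ClassAssumption.ratioBounded {Pi : Finset (Policy S A)} {πstar : Policy S A}
    (h : M.ClassAssumption Pi πstar) {π : Policy S A} (hπ : π ∈ convPolicies Pi) :
    M.RatioBounded π := by
  let K : Set (S → A → ℝ) := {f | ∀ s a, Real.exp (-(M.R / M.β)) * M.ref.1 s a ≤ f s a ∧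
    f s a ≤ Real.exp (M.R / M.β) * M.ref.1 s a}
  have hK : Convex ℝ K := by
    intro f hf g hg u v hu hv huv s a
    have h1 := hf s a
    have h2 := hg s a
    simp only [_root_.Pi.add_apply, _root_.Pi.smul_apply, smul_eq_mul]
    have e : ∀ c : ℝ, c = u * c + v * c := fun c => by rw [← add_mul, huv, one_mul]
    constructor
    · rw [e (Real.exp (-(M.R / M.β)) * M.ref.1 s a)]
      exact add_le_add (mul_le_mul_of_nonneg_left h1.1 hu) (mul_le_mul_of_nonneg_left h2.1 hv)
    · rw [e (Real.exp (M.R / M.β) * M.ref.1 s a)]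
      exact add_le_add (mul_le_mul_of_nonneg_left h1.2 hu) (mul_le_mul_of_nonneg_left h2.2 hv)
  have hsub : Subtype.val '' (Pi : Set (Policy S A)) ⊆ K := by
    rintro _ ⟨π', hπ', rfl⟩
    exact ratioBounded_of_abs_log_le (h.pos π' hπ') (h.bounded_ratio π' hπ')
  exact convexHull_min hsub hK hπ

lemma ClassAssumption.mem_convPolicies {Pi : Finset (Policy S A)} {πstar : Policy S A}
    (h : M.ClassAssumption Pi πstar) : πstar ∈ convPolicies Pi :=
  subset_convexHull ℝ _ ⟨πstar, h.realizable, rfl⟩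

variable (M)

variable {M} in
lemma RatioBounded.abs_klAt_le {π : Policy S A} (h : M.RatioBounded π) (s : S) :
    |M.klAt π s| ≤ M.R / M.β :=
  abs_sum_le_of_abs_le_policy π s (h.abs_log_le s)

/-- `E_{s ∼ ρ, a ∼ π(·|s), ã ∼ π_ref(·|s)} f(s, a, ã)`. -/
noncomputable def pairMean (π : Policy S A) (f : S → A → A → ℝ) : ℝ :=
  ∫ s, ∑ a, ∑ a', π.1 s a * M.ref.1 s a' * f s a a' ∂M.ρ

lemma abs_pairSum_le (π : Policy S A) (s : S) {f : A → A → ℝ} {c : ℝ}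
    (h : ∀ a a', |f a a'| ≤ c) : |∑ a, ∑ a', π.1 s a * M.ref.1 s a' * f a a'| ≤ c := by
  simp only [mul_assoc, ← Finset.mul_sum]
  exact abs_sum_le_of_abs_le_policy π s fun a => abs_sum_le_of_abs_le_policy M.ref s (h a)

lemma rewardOf_mem (π : Policy S A) (s : S) (a : A) : M.rewardOf π s a ∈ Set.Icc 0 M.R :=
  ⟨le_max_left _ _, max_le M.R_pos.le (min_le_left _ _)⟩

lemma one_lt_exp_ratio : 1 < Real.exp (2 * M.R / M.β) :=
  Real.one_lt_exp_iff.2 (div_pos (by linarith [M.R_pos]) M.β_pos)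

variable {M} in
lemma abs_rewardOf_sub_le (π : Policy S A) (s : S) (a a' : A) :
    |M.rewardOf π s a - M.rewardOf π s a'| ≤ M.R := by
  have h1 := M.rewardOf_mem π s a
  have h2 := M.rewardOf_mem π s a'
  rw [abs_le]
  constructor <;> linarith [h1.1, h1.2, h2.1, h2.2]

end Problem

end

section

variable {S A : Type*} [Fintype A] [MeasurableSpace S] [Countable S] [MeasurableSingletonClass S]

namespace Problem

variable (M : Problem S A)

lemma integrable_of_abs_le {f : S → ℝ} {c : ℝ} (h : ∀ s, |f s| ≤ c) : Integrable f M.ρ := by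
  have := M.isProb
  exact Integrable.of_bound (C := c) Measurable.of_discrete.aestronglyMeasurable
    (Filter.Eventually.of_forall h)

lemma integrable_pairSum (π : Policy S A) {f : S → A → A → ℝ} {c : ℝ}
    (h : ∀ s a a', |f s a a'| ≤ c) :
    Integrable (fun s => ∑ a, ∑ a', π.1 s a * M.ref.1 s a' * f s a a') M.ρ :=
  M.integrable_of_abs_le fun s => M.abs_pairSum_le π s (h s)

lemma integrable_sum_rstar (π : Policy S A) :
    Integrable (fun s => ∑ a, π.1 s a * M.rstar s a) M.ρ :=
  M.integrable_of_abs_le (c := M.R) fun s => abs_sum_le_of_abs_le_policy π s fun a => by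
    rw [abs_of_nonneg (M.rstar_mem s a).1]; exact (M.rstar_mem s a).2

end Problem

end

/-! ### The Gibbs form of the optimal policy -/

section

variable {S A : Type*} [Fintype A] [MeasurableSpace S]

namespace Problem

variable (M : Problem S A)

/-- The partition function `Z(s) = ∑ₐ π_ref(a|s) e^{r*(s,a)/β}`. -/
noncomputable def partition (s : S) : ℝ := ∑ a, M.ref.1 s a * Real.exp (M.rstar s a / M.β)

lemma one_le_partition (s : S) : 1 ≤ M.partition s := by
  rw [← (M.ref.2 s).2]
  refine Finset.sum_le_sum fun a _ => le_mul_of_one_le_right (M.ref_pos s a).le ?_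
  exact Real.one_le_exp (div_nonneg (M.rstar_mem s a).1 M.β_pos.le)

lemma partition_le (s : S) : M.partition s ≤ Real.exp (M.R / M.β) :=
  sum_le_of_le_policy M.ref s fun a =>
    Real.exp_le_exp.2 (div_le_div_of_nonneg_right (M.rstar_mem s a).2 M.β_pos.le)

lemma partition_pos (s : S) : 0 < M.partition s := one_pos.trans_le (M.one_le_partition s)

/-- The Gibbs policy, with `π(a|s)` proportional to `π_ref(a|s) e^{r*(s,a)/β}`. -/
noncomputable def gibbs : Policy S A :=
  ⟨fun s a => M.ref.1 s a * Real.exp (M.rstar s a / M.β) / M.partition s, fun s =>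
    ⟨fun a => div_nonneg (mul_nonneg (M.ref_pos s a).le (Real.exp_pos _).le)
      (M.partition_pos s).le, by
      rw [← Finset.sum_div]; exact div_self (M.partition_pos s).ne'⟩⟩

lemma gibbs_ratioBounded : M.RatioBounded M.gibbs := by
  intro s a
  have hr := M.ref_pos s a
  have hZ := M.partition_pos s
  have h1 : 1 ≤ Real.exp (M.rstar s a / M.β) :=
    Real.one_le_exp (div_nonneg (M.rstar_mem s a).1 M.β_pos.le)
  have h2 : Real.exp (M.rstar s a / M.β) ≤ Real.exp (M.R / M.β) :=
    Real.exp_le_exp.2 (div_le_div_of_nonneg_right (M.rstar_mem s a).2 M.β_pos.le)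
  have hE := Real.exp_pos (M.R / M.β)
  change _ ≤ M.ref.1 s a * Real.exp (M.rstar s a / M.β) / M.partition s ∧
    M.ref.1 s a * Real.exp (M.rstar s a / M.β) / M.partition s ≤ _
  rw [le_div_iff₀ hZ, div_le_iff₀ hZ]
  constructor
  · calc Real.exp (-(M.R / M.β)) * M.ref.1 s a * M.partition s
        ≤ Real.exp (-(M.R / M.β)) * M.ref.1 s a * Real.exp (M.R / M.β) := by
          gcongr; exact M.partition_le s
      _ = M.ref.1 s a * 1 := by rw [Real.exp_neg]; field_simp
      _ ≤ _ := by gcongr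
  · calc M.ref.1 s a * Real.exp (M.rstar s a / M.β)
        ≤ M.ref.1 s a * Real.exp (M.R / M.β) := by gcongr
      _ = Real.exp (M.R / M.β) * M.ref.1 s a * 1 := by ring
      _ ≤ _ := by gcongr; exact M.one_le_partition s

lemma log_gibbs_div_ref (s : S) (a : A) :
    Real.log (M.gibbs.1 s a / M.ref.1 s a) = M.rstar s a / M.β - Real.log (M.partition s) := by
  have hr := (M.ref_pos s a).ne'
  have hZ := (M.partition_pos s).ne'
  have : M.gibbs.1 s a / M.ref.1 s a = Real.exp (M.rstar s a / M.β) / M.partition s := by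
    change M.ref.1 s a * Real.exp (M.rstar s a / M.β) / M.partition s / M.ref.1 s a = _
    field_simp
  rw [this, Real.log_div (Real.exp_ne_zero _) hZ, Real.log_exp]

lemma gibbs_klPair_self (s : S) : klPair M.gibbs M.gibbs s = 0 := by
  refine Finset.sum_eq_zero fun a _ => ?_
  rw [div_self (M.gibbs_ratioBounded.pos s a).ne', Real.log_one, mul_zero]

/-- Prompt by prompt, the regularized value is the free energy `β log Z` minus the divergence from
the Gibbs policy. -/
lemma sum_rstar_sub_klAt (π : Policy S A) (s : S) :
    ∑ a, π.1 s a * M.rstar s a - M.β * M.klAt π s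
      = M.β * Real.log (M.partition s) - M.β * klPair π M.gibbs s := by
  have hβ := M.β_pos.ne'
  have key : ∀ a, π.1 s a * Real.log (π.1 s a / M.ref.1 s a)
      = π.1 s a * Real.log (π.1 s a / M.gibbs.1 s a)
        + (π.1 s a * M.rstar s a / M.β - π.1 s a * Real.log (M.partition s)) := by
    intro a
    rcases eq_or_lt_of_le ((π.2 s).1 a) with h0 | hpos
    · simp [← h0]
    · have hg := M.gibbs_ratioBounded.pos s a
      have hr := M.ref_pos s a
      have e : π.1 s a / M.ref.1 s a
          = π.1 s a / M.gibbs.1 s a * (M.gibbs.1 s a / M.ref.1 s a) := by field_simp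
      rw [e, Real.log_mul (div_pos hpos hg).ne' (div_pos hg hr).ne', M.log_gibbs_div_ref]
      ring
  simp only [klAt, key, Finset.sum_add_distrib, Finset.sum_sub_distrib, ← Finset.sum_mul,
    ← Finset.sum_div, (π.2 s).2, klPair]
  field_simp
  ring

end Problem

end

section

variable {S A : Type*} [Fintype A] [MeasurableSpace S] [Countable S] [MeasurableSingletonClass S]

namespace Problem

variable {M : Problem S A}

lemma RatioBounded.integrable_klAt {π : Policy S A} (h : M.RatioBounded π) :
    Integrable (M.klAt π) M.ρ :=
  M.integrable_of_abs_le h.abs_klAt_le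

variable (M) in
lemma J_eq_integral {π : Policy S A} (h : Integrable (M.klAt π) M.ρ) :
    M.J π = ∫ s, (∑ a, π.1 s a * M.rstar s a - M.β * M.klAt π s) ∂M.ρ := by
  rw [integral_sub (M.integrable_sum_rstar π) (h.const_mul _), integral_const_mul]
  rfl

lemma integrable_klPair_gibbs {π : Policy S A} (h : Integrable (M.klAt π) M.ρ) :
    Integrable (klPair π M.gibbs) M.ρ := by
  have h1 := ((M.integrable_sum_rstar M.gibbs).sub
    (M.gibbs_ratioBounded.integrable_klAt.const_mul M.β)).sub
    ((M.integrable_sum_rstar π).sub (h.const_mul M.β))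
  refine (h1.const_mul M.β⁻¹).congr (Filter.Eventually.of_forall fun s => ?_)
  have hβ := M.β_pos.ne'
  simp only [Pi.sub_apply, sum_rstar_sub_klAt, gibbs_klPair_self]
  field_simp
  ring

lemma J_gibbs_sub {π : Policy S A} (h : Integrable (M.klAt π) M.ρ) :
    M.J M.gibbs - M.J π = M.β * ∫ s, klPair π M.gibbs s ∂M.ρ := by
  have hg := M.gibbs_ratioBounded.integrable_klAt
  have hi : ∀ {π' : Policy S A}, Integrable (M.klAt π') M.ρ →
      Integrable (fun s => ∑ a, π'.1 s a * M.rstar s a - M.β * M.klAt π' s) M.ρ :=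
    fun h' => (M.integrable_sum_rstar _).sub (h'.const_mul _)
  rw [M.J_eq_integral h, M.J_eq_integral hg, ← integral_sub (hi hg) (hi h), ← integral_const_mul]
  refine integral_congr_ae (Filter.Eventually.of_forall fun s => ?_)
  simp only [sum_rstar_sub_klAt, gibbs_klPair_self]
  ring

/-- The Gibbs policy is admissible and beats `π` by `β` times the divergence of `π` from it, so that
this divergence vanishes for an optimal policy. -/
lemma IsOptimal.ae_eq_gibbs {πstar : Policy S A} (h : M.IsOptimal πstar) :
    ∀ᵐ s ∂M.ρ, πstar.1 s = M.gibbs.1 s := by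
  have h1 := J_gibbs_sub h.1
  have h2 := h.2 _ M.gibbs_ratioBounded.integrable_klAt
  have hnn : ∀ s, 0 ≤ klPair πstar M.gibbs s :=
    fun s => klPair_nonneg (M.gibbs_ratioBounded.pos s)
  have h3 : ∫ s, klPair πstar M.gibbs s ∂M.ρ = 0 := by
    refine le_antisymm ?_ (integral_nonneg hnn)
    by_contra! hlt
    nlinarith [mul_pos M.β_pos hlt]
  rw [integral_eq_zero_iff_of_nonneg hnn (integrable_klPair_gibbs h.1)] at h3
  filter_upwards [h3] with s hs
  exact eq_of_klPair_eq_zero (M.gibbs_ratioBounded.pos s) hs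

/-- The suboptimality of a policy is `β` times its divergence from the optimal policy. -/
lemma IsOptimal.J_sub_eq {πstar π : Policy S A} (h : M.IsOptimal πstar)
    (hπ : Integrable (M.klAt π) M.ρ) :
    Integrable (klPair π πstar) M.ρ ∧
      M.J πstar - M.J π = M.β * ∫ s, klPair π πstar s ∂M.ρ := by
  have hae : ∀ π' : Policy S A, klPair π' M.gibbs =ᵐ[M.ρ] klPair π' πstar := by
    intro π'
    filter_upwards [h.ae_eq_gibbs] with s hs
    simp only [klPair, hs]
  have h0 : M.J M.gibbs = M.J πstar := by
    have h1 := J_gibbs_sub h.1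
    have h2 : ∫ s, klPair πstar M.gibbs s ∂M.ρ = 0 := by
      rw [integral_eq_zero_of_ae]
      filter_upwards [h.ae_eq_gibbs] with s hs
      have := M.gibbs_klPair_self s
      simp only [klPair, hs] at this ⊢
      exact this
    rw [h2, mul_zero] at h1
    linarith
  refine ⟨(integrable_klPair_gibbs hπ).congr (hae π), ?_⟩
  rw [← h0, J_gibbs_sub hπ, integral_congr_ae (hae π)]

/-- On the support of `ρ`, the reward read off from the optimal policy is the true reward, shifted
to have minimum `0` at each prompt; the clipping has no effect there. -/
lemma IsOptimal.ae_rewardOf_sub {πstar : Policy S A} (h : M.IsOptimal πstar) :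
    ∀ᵐ s ∂M.ρ, ∀ a a', M.rewardOf πstar s a - M.rewardOf πstar s a'
      = M.rstar s a - M.rstar s a' := by
  filter_upwards [h.ae_eq_gibbs] with s hs
  suffices key : ∀ a, M.rewardOf πstar s a = M.rstar s a - ⨅ a', M.rstar s a' by
    intro a a'
    rw [key, key]
    ring
  intro a
  have : Nonempty A := ⟨a⟩
  have hβ := M.β_pos.ne'
  have hlog : ∀ b, M.β * Real.log (πstar.1 s b / M.ref.1 s b)
      = M.rstar s b - M.β * Real.log (M.partition s) := by
    intro b
    rw [hs, M.log_gibbs_div_ref]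
    field_simp
  obtain ⟨b, hb⟩ := exists_eq_ciInf_of_finite (f := fun b => M.rstar s b)
  have hle : ∀ c, M.rstar s b ≤ M.rstar s c := fun c => by
    rw [hb]; exact ciInf_le (Set.finite_range _).bddBelow c
  have hinf : ⨅ c, (M.rstar s c - M.β * Real.log (M.partition s))
      = M.rstar s b - M.β * Real.log (M.partition s) := by
    refine le_antisymm (ciInf_le (Set.finite_range _).bddBelow b) (le_ciInf fun c => ?_)
    linarith [hle c]
  simp only [rewardOf, hlog]
  rw [hinf, ← hb]
  have h1 := hle a
  have h2 := (M.rstar_mem s a).2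
  have h3 := (M.rstar_mem s b).1
  rw [min_eq_right (by linarith), max_eq_right (by linarith)]
  ring

lemma IsOptimal.relReward_rewardOf {πstar : Policy S A} (h : M.IsOptimal πstar)
    (π : Policy S A) :
    M.relReward (M.rewardOf πstar) π = M.expReward M.rstar π - M.expReward M.rstar M.ref := by
  rw [expReward, expReward, ← integral_sub (M.integrable_sum_rstar π)
    (M.integrable_sum_rstar M.ref)]
  refine integral_congr_ae ?_
  filter_upwards [h.ae_rewardOf_sub] with s hs
  simp only [hs, mul_sub, Finset.sum_sub_distrib]
  congr 1
  · refine Finset.sum_congr rfl fun a _ => ?_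
    rw [← Finset.sum_mul, ← Finset.mul_sum, (M.ref.2 s).2, mul_one]
  · simp only [mul_assoc, ← Finset.mul_sum]
    rw [← Finset.sum_mul, (π.2 s).2, one_mul]

/-- Change of measure from the optimal policy to an arbitrary comparable one. -/
lemma IsOptimal.pairMean_le {πstar π : Policy S A} (h : M.IsOptimal πstar)
    (hs : M.RatioBounded πstar) (hπ : M.RatioBounded π) {f : S → A → A → ℝ} {c : ℝ}
    (hf : ∀ s a a', |f s a a'| ≤ c) {l : ℝ} (hl : 0 < l) :
    M.pairMean πstar f ≤ (2 * l)⁻¹ *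
      (1 + kappa (Real.exp (2 * M.R / M.β)) * ((M.J πstar - M.J π) / M.β))
      + l / 2 * M.pairMean π (fun s a a' => f s a a' ^ 2) := by
  have hprob := M.isProb
  obtain ⟨hint, hJ⟩ := h.J_sub_eq hπ.integrable_klAt
  set κ := kappa (Real.exp (2 * M.R / M.β)) with hκ
  have hX := M.one_lt_exp_ratio
  have hf2 : ∀ s a a', |f s a a' ^ 2| ≤ c ^ 2 := fun s a a' => by
    rw [abs_pow]; gcongr; exact hf s a a'
  have hi1 : Integrable (fun s => (2 * l)⁻¹ * (1 + κ * klPair π πstar s)) M.ρ :=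
    ((integrable_const (μ := M.ρ) (1 : ℝ)).add (hint.const_mul κ)).const_mul (2 * l)⁻¹
  have hi2 := (M.integrable_pairSum π hf2).const_mul (l / 2)
  have hJ' : (M.J πstar - M.J π) / M.β = ∫ s, klPair π πstar s ∂M.ρ := by
    rw [hJ, mul_div_cancel_left₀ _ M.β_pos.ne']
  have hRHS : (2 * l)⁻¹ * (1 + κ * ((M.J πstar - M.J π) / M.β))
      + l / 2 * M.pairMean π (fun s a a' => f s a a' ^ 2)
      = ∫ s, ((2 * l)⁻¹ * (1 + κ * klPair π πstar s)
        + l / 2 * ∑ a, ∑ a', π.1 s a * M.ref.1 s a' * f s a a' ^ 2) ∂M.ρ := by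
    rw [hJ', integral_add hi1 hi2, integral_const_mul, integral_const_mul,
      integral_add (integrable_const _) (hint.const_mul κ), integral_const_mul]
    simp [pairMean]
  rw [hRHS]
  refine integral_mono (M.integrable_pairSum πstar hf) (hi1.add hi2) fun s => ?_
  have hsum := sum_sq_div_le (hs.pos s) (hπ.pos s) hX (hs.div_le hπ s)
  calc ∑ a, ∑ a', πstar.1 s a * M.ref.1 s a' * f s a a'
      ≤ ∑ a, ∑ a', ((2 * l)⁻¹ * (πstar.1 s a ^ 2 / π.1 s a) * M.ref.1 s a'
          + l / 2 * (π.1 s a * M.ref.1 s a' * f s a a' ^ 2)) := by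
        refine Finset.sum_le_sum fun a _ => Finset.sum_le_sum fun a' _ => ?_
        have hp := hπ.pos s a
        have hr := M.ref_pos s a'
        -- the difference of the two sides is a positive multiple of a square
        have hsq : (2 * l)⁻¹ * (πstar.1 s a ^ 2 / π.1 s a) * M.ref.1 s a'
          + l / 2 * (π.1 s a * M.ref.1 s a' * f s a a' ^ 2)
          - πstar.1 s a * M.ref.1 s a' * f s a a'
          = M.ref.1 s a' / (2 * l * π.1 s a) * (πstar.1 s a - l * π.1 s a * f s a a') ^ 2 := by
          field_simp
          ring
        have : 0 ≤ M.ref.1 s a' / (2 * l * π.1 s a)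
            * (πstar.1 s a - l * π.1 s a * f s a a') ^ 2 := by positivity
        linarith
    _ = (2 * l)⁻¹ * ∑ a, πstar.1 s a ^ 2 / π.1 s a
          + l / 2 * ∑ a, ∑ a', π.1 s a * M.ref.1 s a' * f s a a' ^ 2 := by
        simp only [Finset.sum_add_distrib, ← Finset.mul_sum, (M.ref.2 s).2, mul_one]
    _ ≤ _ := by gcongr

end Problem

end

/-! ### Existence of a maximizer of the RPO objective -/

section

variable {S A : Type*} [Fintype A]

lemma isCompact_convPolicies (Pi : Finset (Policy S A)) : IsCompact (convPolicies Pi) := by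
  have hc : IsCompact (convexHull ℝ (Subtype.val '' (Pi : Set (Policy S A)))) :=
    (Pi.finite_toSet.image _).isCompact_convexHull ℝ
  rw [Subtype.isCompact_iff]
  have himg : Subtype.val '' convPolicies Pi
      = convexHull ℝ (Subtype.val '' (Pi : Set (Policy S A))) := by
    refine Set.Subset.antisymm (Set.image_subset_iff.2 fun π hπ => hπ) fun f hf => ?_
    have hconv : Convex ℝ {f : S → A → ℝ | ∀ s, f s ∈ stdSimplex ℝ A} :=
      fun f hf g hg u v hu hv huv s => convex_stdSimplex ℝ A (hf s) (hg s) hu hv huv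
    have hsub : Subtype.val '' (Pi : Set (Policy S A)) ⊆ {f | ∀ s, f s ∈ stdSimplex ℝ A} := by
      rintro _ ⟨π, -, rfl⟩
      exact π.2
    exact ⟨⟨f, convexHull_min hsub hconv hf⟩, hf, rfl⟩
  exact himg ▸ hc

lemma continuous_policy_apply (s : S) (a : A) : Continuous fun π : Policy S A => π.1 s a :=
  (continuous_apply_apply s a).comp continuous_subtype_val

end

section

variable {S A : Type*} [Fintype A] [Countable S]

/-- Measurability with respect to the product `σ`-algebra on policies uses that there are countably
many prompts, so that this `σ`-algebra is the Borel one. -/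
lemma measurableSet_convPolicies (Pi : Finset (Policy S A)) :
    MeasurableSet (convPolicies Pi) := by
  have hc : IsCompact (convexHull ℝ (Subtype.val '' (Pi : Set (Policy S A)))) :=
    (Pi.finite_toSet.image _).isCompact_convexHull ℝ
  exact measurable_subtype_coe hc.isClosed.measurableSet

end

section

variable {S A : Type*} [Fintype A] [MeasurableSpace S] [Countable S]
  [MeasurableSingletonClass S]

instance : FirstCountableTopology (Policy S A) :=
  Topology.IsInducing.subtypeVal.firstCountableTopology

namespace Problem

variable {M : Problem S A}

lemma continuous_pairMean {f : S → A → A → ℝ} {c : ℝ} (hf : ∀ s a a', |f s a a'| ≤ c) :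
    Continuous fun π => M.pairMean π f := by
  have := M.isProb
  refine continuous_of_dominated (bound := fun _ => c)
    (fun π => Measurable.of_discrete.aestronglyMeasurable)
    (fun π => Filter.Eventually.of_forall fun s => M.abs_pairSum_le π s (hf s))
    (integrable_const c) (Filter.Eventually.of_forall fun s => ?_)
  exact continuous_finsetSum _ fun a _ => continuous_finsetSum _ fun a' _ =>
    ((continuous_policy_apply s a).mul_const _).mul_const _

lemma ClassAssumption.continuousOn_kl {Pi : Finset (Policy S A)} {πstar : Policy S A}
    (h : M.ClassAssumption Pi πstar) : ContinuousOn M.kl (convPolicies Pi) := by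
  have := M.isProb
  refine continuousOn_of_dominated (bound := fun _ => M.R / M.β)
    (fun π _ => Measurable.of_discrete.aestronglyMeasurable)
    (fun π hπ => Filter.Eventually.of_forall (h.ratioBounded hπ).abs_klAt_le)
    (integrable_const _) (Filter.Eventually.of_forall fun s => ?_)
  refine continuousOn_finsetSum _ fun a _ => ?_
  have hc : ContinuousOn (fun π : Policy S A => π.1 s a) (convPolicies Pi) :=
    (continuous_policy_apply s a).continuousOn
  refine hc.mul ((hc.div_const _).log fun π hπ => ?_)
  exact (div_pos ((h.ratioBounded hπ).pos s a) (M.ref_pos s a)).ne'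

instance (Pi : Finset (Policy S A)) : Finite (M.rewardClass Pi) :=
  (Pi.finite_toSet.image _).to_subtype

lemma ClassAssumption.rpo_nonempty {Pi : Finset (Policy S A)} {πstar : Policy S A}
    (h : M.ClassAssumption Pi πstar) (η : ℝ) {n : ℕ} (D : Fin n → Datum S A) :
    (M.rpo Pi η D).Nonempty := by
  have hcont : UpperSemicontinuousOn (M.rpoObjective Pi η D) (convPolicies Pi) := by
    refine upperSemicontinuousOn_ciInf (fun π _ => (Set.finite_range _).bddBelow) fun r => ?_
    obtain ⟨_, π', -, rfl⟩ := r
    have hrel : Continuous (M.relReward (M.rewardOf π')) :=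
      continuous_pairMean (abs_rewardOf_sub_le π')
    exact (continuousOn_const.add (continuousOn_const.mul (hrel.continuousOn.sub
      (continuousOn_const.mul h.continuousOn_kl)))).upperSemicontinuousOn
  obtain ⟨π, hπ, hmax⟩ := hcont.exists_isMaxOn ⟨πstar, h.mem_convPolicies⟩
    (isCompact_convPolicies Pi)
  exact ⟨π, hπ, hmax⟩

end Problem

end

/-! ### The likelihood-ratio supermartingale -/

section

variable {S A : Type*} [Fintype A] [MeasurableSpace S] [MeasurableSpace A]

namespace Problem

lemma measurable_snoc (n : ℕ) : Measurable fun p : (Fin n → Datum S A) × Datum S A =>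
    (Fin.snoc (α := fun _ => Datum S A) p.1 p.2 : Fin (n + 1) → Datum S A) := by
  refine measurable_pi_lambda _ fun i => ?_
  refine Fin.lastCases ?_ (fun j => ?_) i
  · simpa using measurable_snd
  · simpa using! (measurable_pi_apply j).comp measurable_fst

lemma ae_dataLaw_mem [Countable S] (M : Problem S A)
    (alg : (n : ℕ) → Kernel (Fin n → Datum S A) (Policy S A)) {K : Set (Policy S A)} (hK : MeasurableSet K) (n : ℕ)
    (h : ∀ m < n, ∀ D, ∀ᵐ π ∂alg m D, π ∈ K) :
    ∀ᵐ D ∂M.dataLaw alg n, ∀ i, (D i).1 ∈ K := by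
  induction n with
  | zero => simp
  | succ n ih =>
    have hms : ∀ n, MeasurableSet {D : Fin n → Datum S A | ∀ i, (D i).1 ∈ K} := by
      intro n
      simp only [Set.ofPred_forall]
      exact MeasurableSet.iInter fun i =>
        (measurable_fst.comp (measurable_pi_apply i)) hK
    rw [dataLaw, ae_map_iff (measurable_snoc n).aemeasurable (hms _)]
    refine Measure.ae_compProd_of_ae_ae ((measurable_snoc n) (hms _)) ?_
    filter_upwards [ih fun m hm => h m (hm.trans n.lt_succ_self)] with D hD
    refine Kernel.ae_compProd_of_ae_ae ?_ ?_
    · exact ((measurable_snoc n).comp measurable_prodMk_left) (hms _)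
    · filter_upwards [h n n.lt_succ_self D] with π hπ
      refine Filter.Eventually.of_forall fun z => ?_
      refine Fin.lastCases ?_ fun j => ?_
      · simpa using hπ
      · simpa using hD j

end Problem

end

section

variable {S A : Type*} [Fintype A] [Countable S]
  [MeasurableSpace S] [MeasurableSingletonClass S]
  [MeasurableSpace A] [MeasurableSingletonClass A]

namespace Problem

variable (M : Problem S A) (alg : (n : ℕ) → Kernel (Fin n → Datum S A) (Policy S A))
  [∀ n, IsMarkovKernel (alg n)]

omit [MeasurableSingletonClass A] in
lemma lintegral_dataLaw_succ (n : ℕ) {f : (Fin (n + 1) → Datum S A) → ENNReal}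
    (hf : Measurable f) :
    ∫⁻ D, f D ∂M.dataLaw alg (n + 1) = ∫⁻ h, ∫⁻ π, ∫⁻ z,
      f (Fin.snoc (α := fun _ => Datum S A) h (π, z)) ∂M.outcomeKernel π ∂alg n h
        ∂M.dataLaw alg n := by
  have hs := measurable_snoc (S := S) (A := A) n
  rw [dataLaw, lintegral_map hf hs,
    Measure.lintegral_compProd (f := fun p => f (Fin.snoc p.1 p.2)) (hf.comp hs)]
  refine lintegral_congr fun h => ?_
  rw [Kernel.lintegral_compProd _ _ _
    (f := fun d => f (Fin.snoc (α := fun _ => Datum S A) h d))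
    ((hf.comp hs).comp measurable_prodMk_left)]
  simp [Kernel.prodMkLeft_apply]

/-- Normalizing a non-negative function of the outcome by its conditional mean given the policy
that was played makes the products over the rounds a supermartingale. -/
lemma lintegral_prod_normalized_le_one {g : Outcome S A → ENNReal} (n : ℕ) :
    ∫⁻ D, ∏ i, (g (D i).2 * (∫⁻ z, g z ∂M.outcomeKernel (D i).1)⁻¹) ∂M.dataLaw alg n ≤ 1 := by
  have hg : Measurable g := Measurable.of_discrete
  have hw : Measurable fun d : Datum S A => g d.2 * (∫⁻ z, g z ∂M.outcomeKernel d.1)⁻¹ :=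
    (hg.comp measurable_snd).mul ((hg.lintegral_kernel.comp measurable_fst).inv)
  have hm : ∀ n, Measurable fun D : Fin n → Datum S A =>
      ∏ i, (g (D i).2 * (∫⁻ z, g z ∂M.outcomeKernel (D i).1)⁻¹) := fun n =>
    Finset.measurable_fun_prod _ fun i _ => hw.comp (measurable_pi_apply i)
  induction n with
  | zero => simp
  | succ n ih =>
    rw [M.lintegral_dataLaw_succ alg n (hm (n + 1))]
    refine le_trans (lintegral_mono fun h => ?_) ih
    simp only [Fin.prod_univ_castSucc, Fin.snoc_castSucc, Fin.snoc_last]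
    set P := ∏ i, (g (h i).2 * (∫⁻ z, g z ∂M.outcomeKernel (h i).1)⁻¹)
    calc ∫⁻ π, ∫⁻ z, P * (g z * (∫⁻ z, g z ∂M.outcomeKernel π)⁻¹) ∂M.outcomeKernel π ∂alg n h
        ≤ ∫⁻ π, P ∂alg n h := by
          refine lintegral_mono fun π => ?_
          rw [lintegral_const_mul _ (hg.mul_const _), lintegral_mul_const _ hg]
          -- an inequality only: a mean of `0` or `∞` contributes `0 * ∞ = 0`
          exact mul_le_of_le_one_right' (ENNReal.mul_inv_le_one _)
      _ = P := by simp

lemma lintegral_outcomeKernel (π : Policy S A) (f : Outcome S A → ENNReal) :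
    ∫⁻ z, f z ∂M.outcomeKernel π = ∫⁻ s, ∑ a, ∑ a', ∑ y,
      ENNReal.ofReal (π.1 s a * (M.ref.1 s a' * pref M.rstar s a a' y)) * f (s, a, a', y) ∂M.ρ := by
  have := M.isProb
  change ∫⁻ z, f z ∂(Measure.sum fun z =>
    ENNReal.ofReal (M.outcomeProb π z) • Measure.dirac z) = _
  rw [lintegral_sum_measure, ENNReal.tsum_prod', lintegral_countable']
  refine tsum_congr fun s => ?_
  rw [tsum_fintype, Fintype.sum_prod_type, Finset.sum_mul]
  refine Finset.sum_congr rfl fun a _ => ?_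
  rw [Fintype.sum_prod_type, Finset.sum_mul]
  refine Finset.sum_congr rfl fun a' _ => ?_
  rw [Finset.sum_mul]
  refine Finset.sum_congr rfl fun y _ => ?_
  rw [lintegral_smul_measure, lintegral_dirac, smul_eq_mul, outcomeProb,
    ENNReal.ofReal_mul measureReal_nonneg, ofReal_measureReal]
  ring

end Problem

end

/-! ### Concentration of the likelihood ratio -/

section

variable {S A : Type*}

namespace Problem

lemma pref_pos (r : S → A → ℝ) (s : S) (a a' : A) (y : Bool) : 0 < pref r s a a' y := by
  cases y
  · simpa [pref] using Real.sigmoid_lt_one _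
  · simpa [pref] using Real.sigmoid_pos _

/-- Difference of the reward gaps `r₀(s, a) - r₀(s, ã)` and `r(s, a) - r(s, ã)`. -/
def gapDiff (r₀ r : S → A → ℝ) (s : S) (a a' : A) : ℝ :=
  (r₀ s a - r₀ s a') - (r s a - r s a')

/-- The affinity of two Bradley-Terry models decreases quadratically in the difference of the
reward gaps, with a rate `e^{-2R}`. -/
lemma sum_pref_mul_sqrt_le {R : ℝ} {r₀ r : S → A → ℝ} {s : S} {a a' : A}
    (h₀ : |r₀ s a - r₀ s a'| ≤ R) (h : |r s a - r s a'| ≤ R) :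
    ∑ y, pref r₀ s a a' y * √(pref r s a a' y / pref r₀ s a a' y)
      ≤ 1 - Real.exp (-2 * R) / 64 * gapDiff r₀ r s a a' ^ 2 := by
  have hsqrt : ∀ y, pref r₀ s a a' y * √(pref r s a a' y / pref r₀ s a a' y)
      = √(pref r₀ s a a' y * pref r s a a' y) := by
    intro y
    have h0 := pref_pos r₀ s a a' y
    have h1 := pref_pos r s a a' y
    rw [← Real.sqrt_sq h0.le, ← Real.sqrt_mul (sq_nonneg _), Real.sqrt_sq h0.le]
    congr 1
    field_simp
  rw [Finset.sum_congr rfl fun y _ => hsqrt y]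
  simp only [Fintype.sum_bool, pref, if_true, Bool.false_eq_true, if_false]
  refine (sqrt_mul_add_sqrt_mul_le ⟨Real.sigmoid_nonneg _, Real.sigmoid_le_one _⟩
    ⟨Real.sigmoid_nonneg _, Real.sigmoid_le_one _⟩).trans ?_
  have hgap := exp_neg_mul_abs_sub_le_abs_sigmoid_sub h₀ h
  have hsq := pow_le_pow_left₀ (by positivity) hgap 2
  rw [sq_abs, mul_pow, sq_abs, div_pow, ← Real.exp_nat_mul] at hsq
  have he : ((2 : ℕ) : ℝ) * -R = -2 * R := by push_cast; ring
  rw [he] at hsq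
  unfold gapDiff
  linarith

end Problem

lemma nll_eq [Fintype A] {n : ℕ} (D : Fin n → Datum S A) (r : S → A → ℝ) :
    nll D r = -(1 / (n : ℝ)) * ∑ i, Real.log
      (Problem.pref r (D i).2.1 (D i).2.2.1 (D i).2.2.2.1 (D i).2.2.2.2) := by
  rw [nll, neg_mul, ← mul_neg, ← Finset.sum_neg_distrib]
  congr 1
  refine Finset.sum_congr rfl fun i _ => ?_
  obtain ⟨π, s, a, a', y⟩ := D i
  cases y
  · simp [Problem.pref, ← Real.sigmoid_neg]
  · simp [Problem.pref]

end

section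

variable {S A : Type*} [Fintype A] [Countable S]
  [MeasurableSpace S] [MeasurableSingletonClass S]
  [MeasurableSpace A] [MeasurableSingletonClass A]

namespace Problem

variable (M : Problem S A)

/-- The root of the likelihood ratio of `r` against `r₀`. -/
noncomputable def rootRatio (r₀ r : S → A → ℝ) (z : Outcome S A) : ℝ :=
  √(pref r z.1 z.2.1 z.2.2.1 z.2.2.2 / pref r₀ z.1 z.2.1 z.2.2.1 z.2.2.2)

/-- The normalized product of the roots of the likelihood ratios along a dataset. -/
noncomputable def ratioProduct (r₀ r : S → A → ℝ) {n : ℕ} (D : Fin n → Datum S A) : ENNReal :=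
  ∏ i, (ENNReal.ofReal (rootRatio r₀ r (D i).2) *
    (∫⁻ z, ENNReal.ofReal (rootRatio r₀ r z) ∂M.outcomeKernel (D i).1)⁻¹)

variable {M}

/-- The conditional mean of the root of the likelihood ratio, given the policy that is played.
The outcome is generated by the true reward, so `r₀` only has to have the gaps of the
true reward on the support of `ρ`. -/
lemma lintegral_rootRatio_le {r₀ r : S → A → ℝ} (h₀ : ∀ s a a', |r₀ s a - r₀ s a'| ≤ M.R)
    (h : ∀ s a a', |r s a - r s a'| ≤ M.R)
    (htrue : ∀ᵐ s ∂M.ρ, ∀ a a', r₀ s a - r₀ s a' = M.rstar s a - M.rstar s a')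
    (π : Policy S A) :
    ∫⁻ z, ENNReal.ofReal (rootRatio r₀ r z) ∂M.outcomeKernel π ≤ ENNReal.ofReal
      (Real.exp (-(Real.exp (-2 * M.R) / 64 *
        M.pairMean π fun s a a' => gapDiff r₀ r s a a' ^ 2))) := by
  have := M.isProb
  set c := Real.exp (-2 * M.R) / 64 with hc
  have hbd : ∀ s a a', |gapDiff r₀ r s a a' ^ 2| ≤ (M.R + M.R) ^ 2 := fun s a a' => by
    rw [abs_pow]
    gcongr
    exact (abs_sub _ _).trans (add_le_add (h₀ s a a') (h s a a'))
  set F : S → ℝ := fun s =>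
    1 - c * ∑ a, ∑ a', π.1 s a * M.ref.1 s a' * gapDiff r₀ r s a a' ^ 2 with hF
  set G : S → ℝ := fun s => ∑ a, ∑ a', π.1 s a * M.ref.1 s a' *
    ∑ y, pref r₀ s a a' y * rootRatio r₀ r (s, a, a', y) with hG
  have hG0 : ∀ s, 0 ≤ G s := fun s =>
    Finset.sum_nonneg fun a _ => Finset.sum_nonneg fun a' _ =>
      mul_nonneg (mul_nonneg ((π.2 s).1 a) (M.ref_pos s a').le)
        (Finset.sum_nonneg fun y _ => mul_nonneg (pref_pos _ _ _ _ _).le (Real.sqrt_nonneg _))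
  have hGF : ∀ s, G s ≤ F s := by
    intro s
    calc G s ≤ ∑ a, ∑ a', π.1 s a * M.ref.1 s a' * (1 - c * gapDiff r₀ r s a a' ^ 2) :=
          Finset.sum_le_sum fun a _ => Finset.sum_le_sum fun a' _ =>
            mul_le_mul_of_nonneg_left (sum_pref_mul_sqrt_le (h₀ s a a') (h s a a'))
              (mul_nonneg ((π.2 s).1 a) (M.ref_pos s a').le)
      _ = F s := by
          simp only [hF, mul_sub, Finset.sum_sub_distrib, mul_one, Finset.mul_sum]
          congr 1
          · simp only [← Finset.mul_sum, (M.ref.2 s).2, mul_one, (π.2 s).2]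
          · exact Finset.sum_congr rfl fun a _ => Finset.sum_congr rfl fun a' _ => by ring
  have hFint : Integrable F M.ρ :=
    (integrable_const 1).sub ((M.integrable_pairSum π hbd).const_mul c)
  calc ∫⁻ z, ENNReal.ofReal (rootRatio r₀ r z) ∂M.outcomeKernel π
      = ∫⁻ s, ENNReal.ofReal (G s) ∂M.ρ := by
        rw [lintegral_outcomeKernel]
        refine lintegral_congr_ae ?_
        filter_upwards [htrue] with s hs
        have hpref : ∀ a a' y, pref M.rstar s a a' y = pref r₀ s a a' y := fun a a' y => by
          simp only [pref, hs]
        have h1 : ∀ a a' y, 0 ≤ π.1 s a * (M.ref.1 s a' * pref r₀ s a a' y) := fun a a' y =>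
          mul_nonneg ((π.2 s).1 a) (mul_nonneg (M.ref_pos s a').le (pref_pos _ _ _ _ _).le)
        have h2 : ∀ a a' y, 0 ≤ π.1 s a * (M.ref.1 s a' * pref r₀ s a a' y)
            * rootRatio r₀ r (s, a, a', y) := fun a a' y =>
          mul_nonneg (h1 a a' y) (Real.sqrt_nonneg _)
        simp only [hpref, ← ENNReal.ofReal_mul (h1 _ _ _)]
        have e : G s = ∑ a, ∑ a', ∑ y, π.1 s a * (M.ref.1 s a' * pref r₀ s a a' y)
            * rootRatio r₀ r (s, a, a', y) := by
          simp only [hG, Finset.mul_sum]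
          exact Finset.sum_congr rfl fun a _ => Finset.sum_congr rfl fun a' _ =>
            Finset.sum_congr rfl fun y _ => by ring
        rw [e, ENNReal.ofReal_sum_of_nonneg fun a _ => Finset.sum_nonneg fun a' _ =>
          Finset.sum_nonneg fun y _ => h2 a a' y]
        refine Finset.sum_congr rfl fun a _ => ?_
        rw [ENNReal.ofReal_sum_of_nonneg fun a' _ => Finset.sum_nonneg fun y _ => h2 a a' y]
        refine Finset.sum_congr rfl fun a' _ => ?_
        rw [ENNReal.ofReal_sum_of_nonneg fun y _ => h2 a a' y]
    _ ≤ ∫⁻ s, ENNReal.ofReal (F s) ∂M.ρ :=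
        lintegral_mono fun s => ENNReal.ofReal_le_ofReal (hGF s)
    _ = ENNReal.ofReal (∫ s, F s ∂M.ρ) :=
        (ofReal_integral_eq_lintegral_ofReal hFint
          (Filter.Eventually.of_forall fun s => (hG0 s).trans (hGF s))).symm
    _ ≤ _ := by
        refine ENNReal.ofReal_le_ofReal ?_
        have hI : ∫ s, F s ∂M.ρ
            = 1 - c * M.pairMean π fun s a a' => gapDiff r₀ r s a a' ^ 2 := by
          rw [hF, integral_sub (integrable_const 1) ((M.integrable_pairSum π hbd).const_mul c),
            integral_const_mul]
          simp [pairMean]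
        rw [hI]
        linarith [Real.add_one_le_exp
          (-(c * M.pairMean π fun s a a' => gapDiff r₀ r s a a' ^ 2))]

/-- Outside the exceptional event of Markov's inequality, the likelihood of `r` falls short of that
of `r₀` by the accumulated squared differences of the reward gaps, up to the confidence level. -/
lemma nll_sub_add_le_of_ratioProduct_lt {r₀ r : S → A → ℝ}
    (h₀ : ∀ s a a', |r₀ s a - r₀ s a'| ≤ M.R) (h : ∀ s a a', |r s a - r s a'| ≤ M.R)
    (htrue : ∀ᵐ s ∂M.ρ, ∀ a a', r₀ s a - r₀ s a' = M.rstar s a - M.rstar s a')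
    {n : ℕ} (hn : 1 ≤ n) {D : Fin n → Datum S A} {x : ℝ} (hx : 0 < x)
    (hD : M.ratioProduct r₀ r D < ENNReal.ofReal x) :
    n / 2 * (nll D r₀ - nll D r) + Real.exp (-2 * M.R) / 64 *
      ∑ i, M.pairMean (D i).1 (fun s a a' => gapDiff r₀ r s a a' ^ 2) ≤ Real.log x := by
  set c := Real.exp (-2 * M.R) / 64 with hc
  set V : Fin n → ℝ := fun i => M.pairMean (D i).1 (fun s a a' => gapDiff r₀ r s a a' ^ 2) with hV
  have hroot : ∀ i, 0 < rootRatio r₀ r (D i).2 := fun i =>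
    Real.sqrt_pos.2 (div_pos (pref_pos _ _ _ _ _) (pref_pos _ _ _ _ _))
  have hlow : ENNReal.ofReal (∏ i, rootRatio r₀ r (D i).2 * Real.exp (c * V i))
      ≤ M.ratioProduct r₀ r D := by
    rw [ENNReal.ofReal_prod_of_nonneg fun i _ => (mul_pos (hroot i) (Real.exp_pos _)).le]
    refine Finset.prod_le_prod' fun i _ => ?_
    rw [ENNReal.ofReal_mul (hroot i).le]
    gcongr
    have := lintegral_rootRatio_le h₀ h htrue (D i).1
    rw [← ENNReal.inv_le_inv, Real.exp_neg, ENNReal.ofReal_inv_of_pos (Real.exp_pos _),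
      inv_inv] at this
    exact this
  have hlt := (ENNReal.ofReal_lt_ofReal_iff hx).1 (hlow.trans_lt hD)
  have hprod : 0 < ∏ i, rootRatio r₀ r (D i).2 * Real.exp (c * V i) :=
    Finset.prod_pos fun i _ => mul_pos (hroot i) (Real.exp_pos _)
  have hlog := Real.log_le_log hprod hlt.le
  rw [Real.log_prod fun i _ => (mul_pos (hroot i) (Real.exp_pos _)).ne'] at hlog
  have hterm : ∀ i, Real.log (rootRatio r₀ r (D i).2 * Real.exp (c * V i))
      = 1 / 2 * Real.log (pref r (D i).2.1 (D i).2.2.1 (D i).2.2.2.1 (D i).2.2.2.2)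
        - 1 / 2 * Real.log (pref r₀ (D i).2.1 (D i).2.2.1 (D i).2.2.2.1 (D i).2.2.2.2)
        + c * V i := by
    intro i
    have hp := pref_pos r (D i).2.1 (D i).2.2.1 (D i).2.2.2.1 (D i).2.2.2.2
    have hp₀ := pref_pos r₀ (D i).2.1 (D i).2.2.1 (D i).2.2.2.1 (D i).2.2.2.2
    rw [Real.log_mul (hroot i).ne' (Real.exp_ne_zero _), Real.log_exp, rootRatio,
      Real.log_sqrt (div_pos hp hp₀).le, Real.log_div hp.ne' hp₀.ne']
    ring
  simp only [hterm, Finset.sum_add_distrib, Finset.sum_sub_distrib, ← Finset.mul_sum] at hlog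
  refine le_trans (le_of_eq ?_) hlog
  have hn' : (n : ℝ) ≠ 0 := by positivity
  rw [nll_eq, nll_eq]
  field_simp
  ring

lemma dataLaw_ratioProduct_le (alg : (n : ℕ) → Kernel (Fin n → Datum S A) (Policy S A))
    [∀ n, IsMarkovKernel (alg n)] (r₀ r : S → A → ℝ) (n : ℕ) {x : ℝ} (hx : 0 < x) :
    M.dataLaw alg n {D | ENNReal.ofReal x ≤ M.ratioProduct r₀ r D} ≤ ENNReal.ofReal x⁻¹ := by
  have hg : Measurable fun z : Outcome S A => ENNReal.ofReal (rootRatio r₀ r z) :=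
    Measurable.of_discrete
  have hw : Measurable fun d : Datum S A => ENNReal.ofReal (rootRatio r₀ r d.2) *
      (∫⁻ z, ENNReal.ofReal (rootRatio r₀ r z) ∂M.outcomeKernel d.1)⁻¹ :=
    (hg.comp measurable_snd).mul ((hg.lintegral_kernel.comp measurable_fst).inv)
  have hm : Measurable fun D : Fin n → Datum S A => M.ratioProduct r₀ r D :=
    Finset.measurable_fun_prod _ fun i _ => hw.comp (measurable_pi_apply i)
  have h1 := (mul_meas_ge_le_lintegral (μ := M.dataLaw alg n) hm (ENNReal.ofReal x)).trans
    (M.lintegral_prod_normalized_le_one alg (g := fun z => ENNReal.ofReal (rootRatio r₀ r z)) n)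
  rw [ENNReal.ofReal_inv_of_pos hx, ← one_div,
    ENNReal.le_div_iff_mul_le (Or.inl (ENNReal.ofReal_pos.2 hx).ne')
      (Or.inl ENNReal.ofReal_ne_top), mul_comm]
  exact h1

end Problem

end

/-! ### The regret bound -/

section

variable {S A : Type*} [Fintype A] [Countable S] [MeasurableSpace S] [MeasurableSingletonClass S]

namespace Problem

variable {M : Problem S A}

/-- Comparing the RPO output with the optimal policy in the RPO objective: the adversarial reward
is evaluated at the optimal policy, and the reward read off from the optimal policy at the output,
where the objective is the true value up to a constant. -/
lemma exists_regret_le {Pi : Finset (Policy S A)} {πstar πD : Policy S A}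
    (hopt : M.IsOptimal πstar) (hcls : M.ClassAssumption Pi πstar) {η : ℝ} {n : ℕ}
    {D : Fin n → Datum S A} (hπD : πD ∈ M.rpo Pi η D) :
    ∃ π ∈ Pi, η * (M.J πstar - M.J πD) ≤ nll D (M.rewardOf πstar) - nll D (M.rewardOf π)
      + η * M.pairMean πstar (gapDiff (M.rewardOf πstar) (M.rewardOf π)) := by
  have hne : Nonempty (M.rewardClass Pi) := ⟨⟨_, πstar, hcls.realizable, rfl⟩⟩
  have h1 : M.rpoObjective Pi η D πstar ≤ M.rpoObjective Pi η D πD :=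
    hπD.2 hcls.mem_convPolicies
  have h2 : M.rpoObjective Pi η D πD ≤ nll D (M.rewardOf πstar)
      + η * (M.relReward (M.rewardOf πstar) πD - M.β * M.kl πD) :=
    ciInf_le (f := fun r : M.rewardClass Pi =>
      nll D r.1 + η * (M.relReward r.1 πD - M.β * M.kl πD))
      (Set.finite_range _).bddBelow ⟨_, πstar, hcls.realizable, rfl⟩
  obtain ⟨⟨_, π, hπ, rfl⟩, h3⟩ := exists_eq_ciInf_of_finite (f := fun r : M.rewardClass Pi =>
      nll D r.1 + η * (M.relReward r.1 πstar - M.β * M.kl πstar))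
  refine ⟨π, hπ, ?_⟩
  have h4 : M.pairMean πstar (gapDiff (M.rewardOf πstar) (M.rewardOf π))
      = M.relReward (M.rewardOf πstar) πstar - M.relReward (M.rewardOf π) πstar := by
    rw [relReward, relReward, ← integral_sub
      (M.integrable_pairSum πstar (abs_rewardOf_sub_le πstar))
      (M.integrable_pairSum πstar (abs_rewardOf_sub_le π))]
    simp only [pairMean, gapDiff, mul_sub, Finset.sum_sub_distrib]
  have h5 : M.rpoObjective Pi η D πstar = nll D (M.rewardOf π)
      + η * (M.relReward (M.rewardOf π) πstar - M.β * M.kl πstar) := h3.symm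
  rw [h5] at h1
  rw [h4, hopt.relReward_rewardOf]
  rw [hopt.relReward_rewardOf] at h2
  simp only [J]
  linarith

lemma J_sub_nonneg {Pi : Finset (Policy S A)} {πstar π : Policy S A}
    (hopt : M.IsOptimal πstar) (hcls : M.ClassAssumption Pi πstar) (hπ : π ∈ convPolicies Pi) :
    0 ≤ M.J πstar - M.J π :=
  sub_nonneg.2 (hopt.2 π (hcls.ratioBounded hπ).integrable_klAt)

/-- The regret bound on the event where the likelihood ratios concentrate at level `Λ`. The weight
`e^{-2R} / (16 η)` of the change of measure is chosen such that the accumulated squared reward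
gaps cancel against their contribution to the likelihood. -/
lemma regret_le {Pi : Finset (Policy S A)} {πstar πD : Policy S A}
    (hopt : M.IsOptimal πstar) (hcls : M.ClassAssumption Pi πstar) {T : ℕ} (hT : 1 ≤ T)
    {D : Fin T → Datum S A} (hD : ∀ t, (D t).1 ∈ convPolicies Pi) {Λ η : ℝ} (hΛ : 0 < Λ)
    (hη : η = ((1 + Real.exp M.R) ^ 2)⁻¹ * √(24 / T * Λ))
    (hconc : ∀ π ∈ Pi, T / 2 * (nll D (M.rewardOf πstar) - nll D (M.rewardOf π))
      + Real.exp (-2 * M.R) / 64 * ∑ t, M.pairMean (D t).1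
        (fun s a a' => gapDiff (M.rewardOf πstar) (M.rewardOf π) s a a' ^ 2) ≤ Λ)
    (hπD : πD ∈ M.rpo Pi η D) :
    M.J πstar - M.J πD ≤ 12 * Real.exp (2 * M.R) *
      (1 + kappa (Real.exp (2 * M.R / M.β)) * ∑ t, (M.J πstar - M.J (D t).1) / (M.β * T)) *
      √(Λ / T) := by
  obtain ⟨π, hπ, hreg⟩ := exists_regret_le hopt hcls hπD
  have hc := hconc π hπ
  have hT0 : (0 : ℝ) < T := by exact_mod_cast hT
  have hβ := M.β_pos
  set f := gapDiff (M.rewardOf πstar) (M.rewardOf π) with hf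
  set κ := kappa (Real.exp (2 * M.R / M.β)) with hκ
  have hκ0 : 0 < κ := kappa_pos M.one_lt_exp_ratio
  set V : Fin T → ℝ := fun t => M.pairMean (D t).1 (fun s a a' => f s a a' ^ 2) with hV
  set avg := ∑ t, (M.J πstar - M.J (D t).1) / (M.β * T) with havg
  have havg0 : 0 ≤ avg := Finset.sum_nonneg fun t _ =>
    div_nonneg (J_sub_nonneg hopt hcls (hD t)) (by positivity)
  set q := √(Λ / T) with hq
  have hq0 : 0 < q := Real.sqrt_pos.2 (div_pos hΛ hT0)
  have hq2 : q ^ 2 = Λ / T := Real.sq_sqrt (div_pos hΛ hT0).le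
  have hηq : η = √24 * q / (1 + Real.exp M.R) ^ 2 := by
    rw [hη, hq, ← Real.sqrt_mul (by norm_num), inv_mul_eq_div]
    congr 2
    ring
  have hη0 : 0 < η := by rw [hηq]; positivity
  set E := Real.exp M.R with hE
  have hE1 : 1 < E := Real.one_lt_exp_iff.2 M.R_pos
  have hE2 : Real.exp (2 * M.R) = E ^ 2 := by
    rw [hE, ← Real.exp_nat_mul]; norm_num
  have hE3 : Real.exp (-2 * M.R) = (E ^ 2)⁻¹ := by
    rw [← hE2, ← Real.exp_neg]; congr 1; ring
  rw [hE3] at hc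
  rw [hE2]
  set l := (E ^ 2)⁻¹ / (16 * η) with hl
  have hl0 : 0 < l := by positivity
  have hfbd : ∀ s a a', |f s a a'| ≤ M.R + M.R := fun s a a' =>
    (abs_sub _ _).trans (add_le_add (abs_rewardOf_sub_le πstar s a a')
      (abs_rewardOf_sub_le π s a a'))
  have hcov : M.pairMean πstar f ≤ (2 * l)⁻¹ * (1 + κ * avg) + l / 2 * ((∑ t, V t) / T) := by
    have h1 : ∀ t, M.pairMean πstar f ≤ (2 * l)⁻¹ *
        (1 + κ * ((M.J πstar - M.J (D t).1) / M.β)) + l / 2 * V t := fun t =>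
      hopt.pairMean_le (hcls.ratioBounded hcls.mem_convPolicies) (hcls.ratioBounded (hD t))
        hfbd hl0
    have h2 := Finset.sum_le_sum fun t (_ : t ∈ Finset.univ) => h1 t
    have h3 : ∑ t, (M.J πstar - M.J (D t).1) / M.β = T * avg := by
      rw [havg, Finset.mul_sum]
      exact Finset.sum_congr rfl fun t _ => by field_simp
    simp only [Finset.sum_add_distrib, ← Finset.mul_sum, h3, Finset.sum_const, Finset.card_univ,
      Fintype.card_fin, nsmul_eq_mul, mul_one] at h2
    have h4 : T * ((2 * l)⁻¹ * (1 + κ * avg) + l / 2 * ((∑ t, V t) / T))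
        = (2 * l)⁻¹ * (T + κ * (T * avg)) + l / 2 * ∑ t, V t := by
      field_simp
    exact le_of_mul_le_mul_left (h2.trans h4.ge) hT0
  have hnll : nll D (M.rewardOf πstar) - nll D (M.rewardOf π)
      ≤ 2 * q ^ 2 - (E ^ 2)⁻¹ / 32 * ((∑ t, V t) / T) := by
    rw [hq2]
    refine le_of_mul_le_mul_left ?_ (half_pos hT0)
    have : T / 2 * (2 * (Λ / T) - (E ^ 2)⁻¹ / 32 * ((∑ t, V t) / T))
        = Λ - (E ^ 2)⁻¹ / 64 * ∑ t, V t := by field_simp; ring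
    rw [this]
    linarith
  have hcov' : η * M.pairMean πstar f ≤ 8 * E ^ 2 * η ^ 2 * (1 + κ * avg)
      + (E ^ 2)⁻¹ / 32 * ((∑ t, V t) / T) := by
    refine (mul_le_mul_of_nonneg_left hcov hη0.le).trans (le_of_eq ?_)
    rw [hl]
    field_simp
    ring
  set G := 1 + κ * avg with hG
  have hG1 : 1 ≤ G := by
    have := mul_nonneg hκ0.le havg0
    linarith
  have h24 : (4 : ℝ) ≤ √24 := Real.le_sqrt_of_sq_le (by norm_num)
  have h24' : √24 ≤ 5 := Real.sqrt_le_iff.2 ⟨by norm_num, by norm_num⟩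
  have hq_le : q ≤ η * E ^ 2 := by
    rw [hηq, div_mul_eq_mul_div, le_div_iff₀ (by positivity)]
    calc q * (1 + E) ^ 2 ≤ q * (E + E) ^ 2 := by gcongr
      _ = 4 * q * E ^ 2 := by ring
      _ ≤ √24 * q * E ^ 2 := by gcongr
  have hη_le : η ≤ 5 / 4 * q := by
    rw [hηq, div_le_iff₀ (by positivity)]
    calc √24 * q ≤ 5 * q := by gcongr
      _ = 5 / 4 * q * (1 + 1) ^ 2 := by ring
      _ ≤ 5 / 4 * q * (1 + E) ^ 2 := by gcongr
  refine le_of_mul_le_mul_left ?_ hη0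
  calc η * (M.J πstar - M.J πD) ≤ 2 * q * q * 1 + 8 * E ^ 2 * η * G * η := by linarith
    _ ≤ 2 * q * (η * E ^ 2) * G + 8 * E ^ 2 * η * G * (5 / 4 * q) := by gcongr
    _ = η * (12 * E ^ 2 * G * q) := by ring

end Problem

end

end RLHF

theorem mainTheorem2 :
    ∃ C : ℝ, 0 < C ∧
      ∀ (S A : Type*) [Countable S] [MeasurableSpace S] [MeasurableSingletonClass S]
        [Fintype A] [MeasurableSpace A] [MeasurableSingletonClass A]
        (M : RLHF.Problem S A) (Pi : Finset (RLHF.Policy S A)) (πstar : RLHF.Policy S A)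
        (δ : ℝ) (T : ℕ)
        (alg : (n : ℕ) → ProbabilityTheory.Kernel (Fin n → RLHF.Datum S A) (RLHF.Policy S A))
        [∀ n, ProbabilityTheory.IsMarkovKernel (alg n)],
        M.IsOptimal πstar → M.ClassAssumption Pi πstar →
        0 < δ → δ < 1 → 1 ≤ T →
        (∀ n < T, ∀ h, ∀ᵐ π ∂(alg n h), π ∈ RLHF.convPolicies Pi) →
        (∀ D : Fin T → RLHF.Datum S A, (M.rpo Pi (M.rpoEta Pi T δ) D).Nonempty) ∧
        M.dataLaw alg T {D | ¬ ∀ πDstl ∈ M.rpo Pi (M.rpoEta Pi T δ) D,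
            M.J πstar - M.J πDstl ≤
              C * Real.exp (2 * M.R) *
                (1 + RLHF.kappa (Real.exp (2 * M.R / M.β)) *
                  ∑ t, (M.J πstar - M.J (D t).1) / (M.β * T)) *
                Real.sqrt (Real.log (Pi.card / δ) / T)}
          ≤ ENNReal.ofReal δ := by
  refine ⟨12, by norm_num, ?_⟩
  intro S A _ _ _ _ _ _ M Pi πstar δ T alg _ hopt hcls hδ hδ1 hT halg
  refine ⟨fun D => hcls.rpo_nonempty _ D, ?_⟩
  have hcard : (1 : ℝ) ≤ Pi.card := by
    exact_mod_cast Finset.card_pos.2 ⟨πstar, hcls.realizable⟩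
  have hcard0 : (0 : ℝ) < Pi.card := by linarith
  have hx0 : 0 < Pi.card / δ := div_pos hcard0 hδ
  have hx1 : 1 < Pi.card / δ := by rw [lt_div_iff₀ hδ]; linarith
  have hR := RLHF.Problem.abs_rewardOf_sub_le (M := M)
  have hsub : {D : Fin T → RLHF.Datum S A | ¬ ∀ πDstl ∈ M.rpo Pi (M.rpoEta Pi T δ) D,
      M.J πstar - M.J πDstl ≤ 12 * Real.exp (2 * M.R) *
        (1 + RLHF.kappa (Real.exp (2 * M.R / M.β)) *
          ∑ t, (M.J πstar - M.J (D t).1) / (M.β * T)) *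
        Real.sqrt (Real.log (Pi.card / δ) / T)} ⊆
      {D | ¬ ∀ t, (D t).1 ∈ RLHF.convPolicies Pi} ∪
        ⋃ π ∈ Pi, {D | ENNReal.ofReal (Pi.card / δ)
          ≤ M.ratioProduct (M.rewardOf πstar) (M.rewardOf π) D} := by
    intro D hD
    by_contra hgood
    simp only [Set.mem_union, Set.mem_iUnion, Set.mem_ofPred_eq, not_or, not_not, not_exists,
      not_le] at hgood
    refine hD fun πD hπD => ?_
    exact RLHF.Problem.regret_le hopt hcls hT hgood.1 (Real.log_pos hx1) rfl
      (fun π hπ => RLHF.Problem.nll_sub_add_le_of_ratioProduct_lt (hR πstar) (hR π)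
        hopt.ae_rewardOf_sub hT hx0 (hgood.2 π hπ)) hπD
  refine (measure_mono hsub).trans ((measure_union_le _ _).trans ?_)
  have h0 : M.dataLaw alg T {D | ¬ ∀ t, (D t).1 ∈ RLHF.convPolicies Pi} = 0 :=
    M.ae_dataLaw_mem alg (RLHF.measurableSet_convPolicies Pi) T halg
  rw [h0, zero_add]
  calc M.dataLaw alg T (⋃ π ∈ Pi, {D | ENNReal.ofReal (Pi.card / δ)
          ≤ M.ratioProduct (M.rewardOf πstar) (M.rewardOf π) D})
      -- each candidate reward fails with probability at most `δ / |Π|`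
      ≤ ∑ π ∈ Pi, ENNReal.ofReal (Pi.card / δ)⁻¹ :=
        (measure_biUnion_finset_le _ _).trans (Finset.sum_le_sum fun π _ =>
          RLHF.Problem.dataLaw_ratioProduct_le alg _ _ T hx0)
    _ = ENNReal.ofReal δ := by
        rw [Finset.sum_const, nsmul_eq_mul, ← ENNReal.ofReal_natCast,
          ← ENNReal.ofReal_mul hcard0.le]
        congr 1
        field_simp
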